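/- Let $\mathbb H$ be the quaternions and $\mathbb H[[z]]$ the ring of formal power series $f=\sum_{k\ge0} f_kz^k$ with quaternionic coefficients, $z$ commuting with the coefficients; put $f^\sharp=\sum_k \overline{f_k}z^k$ and $\|f\|^2=\sum_k|f_k|^2\in[0,\infty]$. The Schur class $\mathcal S_{\mathbb H}$ consists of all $f$ with $\|fh\|\le\|h\|$ for every $h$ with $\|h\|<\infty$. Let $\mathcal H_1=\{f:\limsup_k|f_k|^{1/k}\le1\}$. For $f\in\mathcal H_1$, a point $\gamma$ with $|\gamma|<1$ is a left (right) zero of $f$ if $\sum_k\gamma^kf_k=0$ (respectively $\sum_kf_k\gamma^k=0$); a zero is a left or a right zero. For $|\alpha|<1$ put ${\bf b}_\alpha=(z-\alpha)(1-z\overline\alpha)^{-1}$. A finite Blaschke product is a series ${\bf b}_{\alpha_1}\cdots{\bf b}_{\alpha_n}\phi$ with $n\ge0$, $|\alpha_j|<1$, $|\phi|=1$; it is called normalized if it can be written in this way with $\phi=1$. Let $[\alpha]=\{h\alpha h^{-1}:h\in\mathbb H\setminus\{0\}\}$. For $V=[\alpha]$ with $\alpha$ non-real and $|\alpha|<1$,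 put $\mathcal X_V=z^2-2z\,\mathrm{Re}\,\alpha+|\alpha|^2$ and $\mathcal B_V={\bf b}_\alpha{\bf b}_{\alpha}^\sharp$ (these depend on $V$ only). Such a $V$ is a spherical zero of $g\in\mathcal H_1$ if it contains two distinct left zeros or two distinct right zeros of $g$, and $m_s(V;f)=n$ means that $f=\mathcal X_V^n g$ for some $g\in\mathcal H_1$ for which $V$ is not a spherical zero. A real $x\in(-1,1)$ is a zero of $f$ of multiplicity $\pi$ if $f=(z-x)^\pi g$ for some $g\in\mathcal H_1$ with no zero at $x$. A spherical chain in $V$ is a finite sequence $(\alpha_1,\dots,\alpha_k)$ in $V$ with $\alpha_{j+1}\ne\overline{\alpha_j}$ for $j=1,\dots,k-1$. **Theorem.** Let $f\in\mathcal S_{\mathbb H}$, $f\neq0$, and let $V$ be a similarity class containing a zero of $f$. Then there exist unique normalized finite Blaschke products $B_{\ell,V}$ and $B_{r,V}$ with all zeros in $V$ such that $$f=B_{\ell,V}H_V=G_VB_{r,V}$$ for some $H_V,G_V\in\mathcal S_{\mathbb H}$ having no zeros in $V$. Among all finite Blaschke products, $B_{\ell,V}$ is unique up to a unimodular constant factor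 on the right, and $B_{r,V}$ up to a unimodular constant factor on the left. More precisely: 1. If $V=\{x\}$ with $x$ real, then $x$ is a zero of $f$ of some multiplicity $\pi\ge1$, and $B_{\ell,V}=B_{r,V}={\bf b}_x^\pi$. If $V$ is the class of a non-real quaternion, then $m_s(V;f)$ and $m_s(V;ff^\sharp)$ exist, $m_s(V;ff^\sharp)\ge 2m_s(V;f)$ and $m_s(V;ff^\sharp)>0$, and: 2. If $m_s(V;ff^\sharp)=2m_s(V;f)=2\kappa>0$, then $B_{\ell,V}=B_{r,V}=\mathcal B_V^\kappa$. 3. If $m_s(V;f)=\kappa\ge0$ and $m_s(V;ff^\sharp)-2m_s(V;f)=k>0$, then there exist unique spherical chains $(\alpha_1,\dots,\alpha_k)$ and $(\widetilde\alpha_1,\dots,\widetilde\alpha_k)$ in $V$ such that $$B_{\ell,V}=\mathcal B_V^\kappa\,{\bf b}_{\alpha_1}\cdots{\bf b}_{\alpha_k}\quad\text{and}\quad B_{r,V}={\bf b}_{\widetilde\alpha_k}\cdots{\bf b}_{\widetilde\alpha_1}\,\mathcal B_V^\kappa.$$ -/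

import Mathlib

open scoped Quaternion ENNReal

namespace QSchur

/-- The ring of formal power series with quaternionic coefficients in a variable `z`
that commutes with the coefficients (the product is the Cauchy product). -/
abbrev QSeries : Type := PowerSeries ℍ[ℝ]

/-- The involution `f ↦ f♯` conjugating all the coefficients. -/
noncomputable def sharp (f : QSeries) : QSeries :=
  PowerSeries.mk fun k => star (PowerSeries.coeff k f)

/-- Membership in `ℋ₁`: `limsup |f_k|^(1/k) ≤ 1` (computed in `[0, ∞]`). -/
def InH1 (f : QSeries) : Prop :=
  Filter.limsup (fun k : ℕ => ‖PowerSeries.coeff k f‖ₑ ^ (1 / (k : ℝ))) Filter.atTop ≤ 1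

/-- Left evaluation `∑ γ^k f_k`. -/
noncomputable def leftEval (f : QSeries) (γ : ℍ[ℝ]) : ℍ[ℝ] :=
  ∑' k : ℕ, γ ^ k * PowerSeries.coeff k f

/-- Right evaluation `∑ f_k γ^k`. -/
noncomputable def rightEval (f : QSeries) (γ : ℍ[ℝ]) : ℍ[ℝ] :=
  ∑' k : ℕ, PowerSeries.coeff k f * γ ^ k

/-- Left zeros in the open unit ball (used for series in `ℋ₁`). -/
def IsLeftZero (f : QSeries) (γ : ℍ[ℝ]) : Prop := ‖γ‖ < 1 ∧ leftEval f γ = 0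

/-- Right zeros in the open unit ball (used for series in `ℋ₁`). -/
def IsRightZero (f : QSeries) (γ : ℍ[ℝ]) : Prop := ‖γ‖ < 1 ∧ rightEval f γ = 0

/-- A zero is a left zero or a right zero. -/
def IsZero (f : QSeries) (γ : ℍ[ℝ]) : Prop := IsLeftZero f γ ∨ IsRightZero f γ

/-- The squared norm `∑ |f_k|²` of the Hardy space, with value `∞` outside of the space. -/
noncomputable def hardyNormSq (f : QSeries) : ℝ≥0∞ :=
  ∑' k : ℕ, ‖PowerSeries.coeff k f‖ₑ ^ 2

/-- The Schur class: contractive (left) multipliers of the Hardy space. -/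
def IsSchur (f : QSeries) : Prop :=
  ∀ h : QSeries, hardyNormSq h < ∞ → hardyNormSq (f * h) ≤ hardyNormSq h

/-- The similarity class `[α]`. -/
def simClass (α : ℍ[ℝ]) : Set ℍ[ℝ] := {β | ∃ h : ℍ[ℝ], h ≠ 0 ∧ β = h * α * h⁻¹}

/-- The polynomial `z - α`. -/
noncomputable def rho (α : ℍ[ℝ]) : QSeries := PowerSeries.X - PowerSeries.C α

/-- The series `∑ ᾱ^k z^k`, the inverse of `1 - z ᾱ`. -/
noncomputable def kern (α : ℍ[ℝ]) : QSeries := PowerSeries.mk fun k => star α ^ k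

/-- The Blaschke factor `(z - α)(1 - z ᾱ)⁻¹`. -/
noncomputable def blaschke (α : ℍ[ℝ]) : QSeries := rho α * kern α

/-- The polynomial `z² - 2 z Re α + |α|²` of the sphere `[α]`. -/
noncomputable def sphPoly (α : ℍ[ℝ]) : QSeries :=
  PowerSeries.X ^ 2 - PowerSeries.C ((2 * α.re : ℝ) : ℍ[ℝ]) * PowerSeries.X
    + PowerSeries.C ((‖α‖ ^ 2 : ℝ) : ℍ[ℝ])

/-- The Blaschke factor of the sphere `[α]`. -/
noncomputable def sphBlaschke (α : ℍ[ℝ]) : QSeries := blaschke α * sharp (blaschke α)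

/-- Products `b_{α₁} ⋯ b_{αₙ}` of finitely many Blaschke factors (`1` if `n = 0`). -/
def IsBlaschkeProd (B : QSeries) : Prop :=
  ∃ l : List ℍ[ℝ], (∀ a ∈ l, ‖a‖ < 1) ∧ B = (l.map blaschke).prod

/-- Finite Blaschke products `b_{α₁} ⋯ b_{αₙ} φ` with a unimodular constant `φ`. -/
def IsFiniteBlaschke (B : QSeries) : Prop :=
  ∃ P : QSeries, IsBlaschkeProd P ∧ ∃ φ : ℍ[ℝ], ‖φ‖ = 1 ∧ B = P * PowerSeries.C φ

/-- All (left and right) zeros of `B` lie in `V`. -/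
def ZerosIn (B : QSeries) (V : Set ℍ[ℝ]) : Prop := ∀ γ, IsZero B γ → γ ∈ V

/-- `H` has neither left nor right zeros in `V`. -/
def NoZerosIn (H : QSeries) (V : Set ℍ[ℝ]) : Prop := ∀ γ ∈ V, ¬ IsZero H γ

/-- `B` is a finite Blaschke product with all zeros in `V`, and `f = B H` for some
Schur-class `H` without zeros in `V`. -/
def IsLeftBlaschkeDivisor (f : QSeries) (V : Set ℍ[ℝ]) (B : QSeries) : Prop :=
  IsFiniteBlaschke B ∧ ZerosIn B V ∧ ∃ H : QSeries, IsSchur H ∧ NoZerosIn H V ∧ f = B * H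

/-- `B` is a finite Blaschke product with all zeros in `V`, and `f = G B` for some
Schur-class `G` without zeros in `V`. -/
def IsRightBlaschkeDivisor (f : QSeries) (V : Set ℍ[ℝ]) (B : QSeries) : Prop :=
  IsFiniteBlaschke B ∧ ZerosIn B V ∧ ∃ G : QSeries, IsSchur G ∧ NoZerosIn G V ∧ f = G * B

/-- The real point `x` has multiplicity `n` for `f`: `f = (z - x)^n g`, where `g ∈ ℋ₁` has
no zero at `x`. -/
def HasRealMult (f : QSeries) (x : ℝ) (n : ℕ) : Prop :=
  ∃ g : QSeries, InH1 g ∧ ¬ IsZero g (x : ℍ[ℝ]) ∧ f = rho (x : ℍ[ℝ]) ^ n * g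

/-- `V` is a spherical zero of `f`: it contains two distinct left zeros or two distinct right
zeros of `f`. -/
def IsSphericalZero (f : QSeries) (V : Set ℍ[ℝ]) : Prop :=
  (∃ β ∈ V, ∃ γ ∈ V, β ≠ γ ∧ IsLeftZero f β ∧ IsLeftZero f γ) ∨
    (∃ β ∈ V, ∃ γ ∈ V, β ≠ γ ∧ IsRightZero f β ∧ IsRightZero f γ)

/-- The sphere `[α]` (`α` not real) has spherical multiplicity `n` for `f`: `f = 𝒳^n g` with
`𝒳` the polynomial of the sphere, where `g ∈ ℋ₁` and `[α]` is not a spherical zero of `g`. -/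
def HasSphMult (f : QSeries) (α : ℍ[ℝ]) (n : ℕ) : Prop :=
  ∃ g : QSeries, InH1 g ∧ ¬ IsSphericalZero g (simClass α) ∧ f = sphPoly α ^ n * g

/-- Spherical chains in the similarity class `V`: consecutive elements are not
conjugates of each other. -/
def IsSphericalChain (V : Set ℍ[ℝ]) (l : List ℍ[ℝ]) : Prop :=
  (∀ a ∈ l, a ∈ V) ∧ l.IsChain fun a b => b ≠ star a

end QSchur

open QSchur

namespace QSchur

open PowerSeries Filter Topology

/-!
The series `f * f♯` has real coefficients, so it is central and vanishes on all of `[α]` as soon as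
`f` has a zero in `[α]`. Since `(f g) (f g)♯ = (f f♯) (g g♯)`, having no zeros in `[α]` is
multiplicative. A left zero `a` of a Schur-class `f` gives `f = b_a H` with `H` again in the Schur
class; the extraction of zeros lying in `[α]` terminates because the lowest nonzero coefficient of
`f` would otherwise be arbitrarily small (`α ≠ 0`), or the order of `f` infinite (`α = 0`). In a
product of Blaschke factors from `[α]` neighbours `b_a b_{ā} = 𝓑_V` cancel into a central factor,
leaving a spherical chain. If `H` has no zeros in `[α]`, the only left zero in `[α]` of
`b_{α₁} ⋯ b_{αₖ} H` is `α₁`, so the chain can be read off from the product one factor at a time.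
The assertions about right divisors follow by applying `♯`.
-/

/-! ### Power series over noncommutative rings -/

theorem commute_of_coeff_commute {R : Type*} [Semiring R] {f g : R⟦X⟧}
    (h : ∀ i j, Commute (coeff i f) (coeff j g)) : Commute f g := by
  ext1 n
  rw [coeff_mul, coeff_mul, ← Finset.Nat.sum_antidiagonal_swap]
  exact Finset.sum_congr rfl fun p _ => h _ _

theorem X_sub_C_mul_X_sub_C {R : Type*} [Ring R] (a b : R) :
    (X - C a) * (X - C b) = (X ^ 2 - C (a + b) * X + C (a * b) : R⟦X⟧) := by
  rw [map_add, map_mul, mul_sub, sub_mul, sub_mul, (commute_X (C b)).symm.eq]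
  noncomm_ring

theorem one_sub_C_mul_X_mul_one_sub_C_mul_X {R : Type*} [Ring R] (a b : R) :
    (1 - C a * X) * (1 - C b * X) = (1 - C (a + b) * X + C (a * b) * X ^ 2 : R⟦X⟧) := by
  have hX : (C a * X * (C b * X) : R⟦X⟧) = C a * C b * X ^ 2 := by
    rw [mul_assoc, ← mul_assoc X, X_mul]
    noncomm_ring
  rw [map_add, map_mul, mul_sub, sub_mul, sub_mul, hX]
  noncomm_ring

/-! ### The involution `f ↦ f♯` -/

@[simp]
theorem coeff_sharp (k : ℕ) (f : QSeries) : coeff k (sharp f) = star (coeff k f) := by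
  simp [sharp]

@[simp]
theorem sharp_sharp (f : QSeries) : sharp (sharp f) = f := by
  ext1 k
  simp

theorem sharp_injective : Function.Injective sharp :=
  Function.LeftInverse.injective sharp_sharp

theorem sharp_mul (f g : QSeries) : sharp (f * g) = sharp g * sharp f := by
  ext1 k
  simp only [coeff_sharp, coeff_mul, star_sum, star_mul]
  exact (Finset.Nat.sum_antidiagonal_swap (n := k)
    (f := fun p => star (coeff p.2 g) * star (coeff p.1 f))).symm

@[simp]
theorem sharp_C (a : ℍ[ℝ]) : sharp (C a) = C (star a) := by
  ext1 k
  simp only [coeff_sharp, coeff_C]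
  split_ifs <;> simp

@[simp]
theorem sharp_one : sharp 1 = 1 := by
  simpa using sharp_C 1

@[simp]
theorem sharp_zero : sharp 0 = 0 := by
  simpa using sharp_C 0

theorem sharp_pow (f : QSeries) (n : ℕ) : sharp (f ^ n) = sharp f ^ n := by
  induction n with
  | zero => simp
  | succ n ih => rw [pow_succ, sharp_mul, ih, ← pow_succ']

theorem commute_of_sharp_eq {f : QSeries} (hf : sharp f = f) (g : QSeries) : Commute f g :=
  commute_of_coeff_commute fun i j => by
    have hstar : star (coeff i f) = coeff i f := by rw [← coeff_sharp, hf]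
    rw [Quaternion.star_eq_self.1 hstar]
    exact Quaternion.coe_commutes _ _

theorem re_mul_comm (a b : ℍ[ℝ]) : (a * b).re = (b * a).re := by
  simp only [Quaternion.re_mul]
  ring

theorem re_sum {ι : Type*} (s : Finset ι) (q : ι → ℍ[ℝ]) :
    (∑ i ∈ s, q i).re = ∑ i ∈ s, (q i).re :=
  map_sum (QuaternionAlgebra.reₗ (-1 : ℝ) 0 (-1)) q s

theorem re_coeff_mul_comm (f g : QSeries) (n : ℕ) :
    (coeff n (f * g)).re = (coeff n (g * f)).re := by
  rw [coeff_mul, coeff_mul, ← Finset.Nat.sum_antidiagonal_swap, re_sum, re_sum]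
  exact Finset.sum_congr rfl fun p _ => re_mul_comm _ _

theorem sharp_mul_sharp_self (f : QSeries) : sharp (f * sharp f) = f * sharp f := by
  rw [sharp_mul, sharp_sharp]

theorem coeff_eq_re_of_sharp_eq {f : QSeries} (hf : sharp f = f) (n : ℕ) :
    coeff n f = ((coeff n f).re : ℍ[ℝ]) :=
  Quaternion.star_eq_self.1 (by rw [← coeff_sharp, hf])

theorem sharp_mul_self (f : QSeries) : sharp f * f = f * sharp f := by
  have hleft : sharp (sharp f * f) = sharp f * f := by rw [sharp_mul, sharp_sharp]
  ext1 n
  rw [coeff_eq_re_of_sharp_eq hleft, coeff_eq_re_of_sharp_eq (sharp_mul_sharp_self f),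
    re_coeff_mul_comm]

theorem mul_sharp_mul (f g : QSeries) :
    f * g * sharp (f * g) = f * sharp f * (g * sharp g) := by
  have h := commute_of_sharp_eq (sharp_mul_sharp_self g) (sharp f)
  rw [sharp_mul, mul_assoc, ← mul_assoc g, h.eq, ← mul_assoc]

/-! ### Similarity classes -/

theorem re_mul_conj_eq_and_norm (a : ℍ[ℝ]) {h : ℍ[ℝ]} (h0 : h ≠ 0) :
    (h * a * h⁻¹).re = a.re ∧ ‖h * a * h⁻¹‖ = ‖a‖ := by
  refine ⟨by rw [re_mul_comm, inv_mul_cancel_left₀ h0], ?_⟩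
  rw [norm_mul, norm_mul, norm_inv, mul_right_comm, mul_inv_cancel₀ (norm_ne_zero_iff.2 h0),
    one_mul]

/-- Both `a` and `b` are roots of the real polynomial `t² - 2 t Re a + |a|²`. -/
theorem semiconjBy_sub_star {a b : ℍ[ℝ]} (hre : b.re = a.re) (hnorm : ‖b‖ = ‖a‖) :
    SemiconjBy (b - star a) a b := by
  have hadd : a + star a = b + star b := by
    rw [Quaternion.self_add_star', Quaternion.self_add_star', hre]
  have hmul : star a * a = b * star b := by
    rw [Quaternion.star_mul_self, Quaternion.self_mul_star, Quaternion.normSq_eq_norm_mul_self,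
      Quaternion.normSq_eq_norm_mul_self, hnorm]
  calc (b - star a) * a = b * (a + star a) - b * star a - star a * a := by noncomm_ring
    _ = b * (b - star a) := by rw [hadd, hmul]; noncomm_ring

theorem exists_ne_zero_semiconjBy_star (a : ℍ[ℝ]) : ∃ h ≠ 0, SemiconjBy h a (star a) := by
  -- any nonzero pure quaternion orthogonal to the vector part of `a`
  obtain ⟨x, y, hxy, horth⟩ : ∃ x y : ℝ, (x ≠ 0 ∨ y ≠ 0) ∧ x * a.imI + y * a.imJ = 0 := by
    by_cases h : a.imI = 0
    · exact ⟨1, 0, by simp, by simp [h]⟩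
    · exact ⟨-a.imJ, a.imI, Or.inr h, by ring⟩
  obtain ⟨h, hre, hI, hJ, hK⟩ : ∃ h : ℍ[ℝ], h.re = 0 ∧ h.imI = x ∧ h.imJ = y ∧ h.imK = 0 :=
    ⟨⟨0, x, y, 0⟩, rfl, rfl, rfl, rfl⟩
  refine ⟨h, ?_, ?_⟩
  · rintro rfl
    exact hxy.elim (· hI.symm) (· hJ.symm)
  · rw [SemiconjBy]
    ext <;> simp only [Quaternion.re_mul, Quaternion.imI_mul, Quaternion.imJ_mul,
      Quaternion.imK_mul, Quaternion.re_star, Quaternion.imI_star, Quaternion.imJ_star,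
      Quaternion.imK_star, hre, hI, hJ, hK] <;> linarith

theorem mem_simClass_iff {a b : ℍ[ℝ]} : b ∈ simClass a ↔ b.re = a.re ∧ ‖b‖ = ‖a‖ := by
  refine ⟨?_, fun ⟨hre, hnorm⟩ => ?_⟩
  · rintro ⟨h, h0, rfl⟩
    exact re_mul_conj_eq_and_norm a h0
  · obtain ⟨h, h0, e⟩ : ∃ h ≠ 0, SemiconjBy h a b := by
      by_cases hb : b = star a
      · exact hb ▸ exists_ne_zero_semiconjBy_star a
      · exact ⟨b - star a, sub_ne_zero.2 hb, semiconjBy_sub_star hre hnorm⟩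
    exact ⟨h, h0, by rw [e.eq, mul_inv_cancel_right₀ h0]⟩

theorem self_mem_simClass (a : ℍ[ℝ]) : a ∈ simClass a :=
  mem_simClass_iff.2 ⟨rfl, rfl⟩

theorem star_mem_simClass {a b : ℍ[ℝ]} : star b ∈ simClass a ↔ b ∈ simClass a := by
  simp [mem_simClass_iff]

theorem norm_eq_of_mem_simClass {a b : ℍ[ℝ]} (h : b ∈ simClass a) : ‖b‖ = ‖a‖ :=
  (mem_simClass_iff.1 h).2

theorem simClass_eq_of_mem {a b : ℍ[ℝ]} (h : b ∈ simClass a) : simClass b = simClass a := by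
  obtain ⟨hre, hnorm⟩ := mem_simClass_iff.1 h
  ext c
  rw [mem_simClass_iff, mem_simClass_iff, hre, hnorm]

theorem mem_simClass_comm {a b : ℍ[ℝ]} : b ∈ simClass a ↔ a ∈ simClass b := by
  simp only [mem_simClass_iff, eq_comm]

theorem inv_mul_mul_mem_simClass (a : ℍ[ℝ]) {h : ℍ[ℝ]} (h0 : h ≠ 0) :
    h⁻¹ * a * h ∈ simClass a :=
  ⟨h⁻¹, inv_ne_zero h0, by rw [inv_inv]⟩

theorem mem_simClass_coe {x : ℝ} {b : ℍ[ℝ]} : b ∈ simClass (x : ℍ[ℝ]) ↔ b = x := by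
  refine ⟨?_, fun h => h ▸ self_mem_simClass _⟩
  rintro ⟨h, h0, rfl⟩
  rw [← Quaternion.coe_commutes, mul_inv_cancel_right₀ h0]

/-! ### Blaschke factors -/

/-- The polynomial `1 - ᾱ z`, the inverse of `kern α`. -/
noncomputable def kernInv (a : ℍ[ℝ]) : QSeries := 1 - C (star a) * X

theorem kern_mul_kernInv (a : ℍ[ℝ]) : kern a * kernInv a = 1 := by
  rw [kernInv, mul_sub, mul_one, ← mul_assoc]
  ext1 k
  cases k with
  | zero => simp [kern]
  | succ k => simp [kern, coeff_mul_C, pow_succ, coeff_one, coeff_succ_mul_X]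

@[simp]
theorem sharp_rho (a : ℍ[ℝ]) : sharp (rho a) = rho (star a) := by
  ext1 k
  simp only [coeff_sharp, rho, map_sub, coeff_C, coeff_X, star_sub]
  split_ifs <;> simp

theorem sharp_kern (a : ℍ[ℝ]) : sharp (kern a) = kern (star a) := by
  ext1 k
  simp [kern]

theorem commute_rho_kern {a b : ℍ[ℝ]} (h : Commute a (star b)) : Commute (rho a) (kern b) := by
  refine commute_of_coeff_commute fun i j => ?_
  simp only [rho, kern, map_sub, coeff_X, coeff_C, coeff_mk]
  split_ifs <;> simp [h.pow_right j, Commute.sub_left]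

theorem sharp_blaschke (a : ℍ[ℝ]) : sharp (blaschke a) = blaschke (star a) := by
  have h : Commute (rho (star a)) (kern (star a)) := commute_rho_kern star_comm_self.symm
  rw [blaschke, sharp_mul, sharp_rho, sharp_kern, blaschke, h.eq]

theorem rho_ne_zero (a : ℍ[ℝ]) : rho a ≠ 0 := fun h => by
  simpa [rho] using congrArg (coeff 1) h

theorem blaschke_ne_zero (a : ℍ[ℝ]) : blaschke a ≠ 0 :=
  mul_ne_zero (rho_ne_zero a) (left_ne_zero_of_mul_eq_one (kern_mul_kernInv a))

theorem blaschke_mul_kernInv_mul (a : ℍ[ℝ]) (u : QSeries) :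
    blaschke a * (kernInv a * u) = rho a * u := by
  rw [blaschke, mul_assoc, ← mul_assoc (kern a), kern_mul_kernInv, one_mul]

section

variable {φ a b : ℍ[ℝ]}

theorem semiconjBy_C_rho (h : SemiconjBy φ a b) : SemiconjBy (C φ) (rho a) (rho b) :=
  SemiconjBy.sub_right (commute_X (C φ)) (h.map C)

theorem semiconjBy_C_kern (h : SemiconjBy φ (star a) (star b)) :
    SemiconjBy (C φ) (kern a) (kern b) := by
  ext1 k
  simp only [kern, coeff_C_mul, coeff_mul_C, coeff_mk]
  exact h.pow_right k

theorem semiconjBy_C_blaschke (h : SemiconjBy φ a b) (h' : SemiconjBy φ (star a) (star b)) :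
    SemiconjBy (C φ) (blaschke a) (blaschke b) :=
  (semiconjBy_C_rho h).mul_right (semiconjBy_C_kern h')

end

/-! ### The Blaschke factor of a sphere -/

theorem rho_mul_rho_star (a : ℍ[ℝ]) : rho a * rho (star a) = sphPoly a := by
  rw [rho, rho, X_sub_C_mul_X_sub_C, Quaternion.self_add_star', Quaternion.self_mul_star,
    Quaternion.normSq_eq_norm_mul_self, ← sq, sphPoly]

theorem sphPoly_eq_of_mem {a b : ℍ[ℝ]} (h : b ∈ simClass a) : sphPoly b = sphPoly a := by
  obtain ⟨hre, hnorm⟩ := mem_simClass_iff.1 h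
  rw [sphPoly, sphPoly, hre, hnorm]

theorem sharp_sphPoly (a : ℍ[ℝ]) : sharp (sphPoly a) = sphPoly a := by
  rw [← rho_mul_rho_star, sharp_mul, sharp_rho, sharp_rho, star_star]

theorem commute_sphPoly (a : ℍ[ℝ]) (f : QSeries) : Commute (sphPoly a) f :=
  commute_of_sharp_eq (sharp_sphPoly a) f

theorem sphPoly_ne_zero (a : ℍ[ℝ]) : sphPoly a ≠ 0 := by
  rw [← rho_mul_rho_star]
  exact mul_ne_zero (rho_ne_zero _) (rho_ne_zero _)

/-- The unit `𝓑_V / 𝒳_V` of the ring of power series, which exchanges powers of `𝒳_V` for powers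
of `𝓑_V` without affecting zeros. -/
noncomputable def sphKern (a : ℍ[ℝ]) : QSeries := kern a * kern (star a)

theorem kernInv_star_mul_kernInv (a : ℍ[ℝ]) :
    kernInv (star a) * kernInv a = 1 - C ((2 * a.re : ℝ) : ℍ[ℝ]) * X
      + C ((‖a‖ ^ 2 : ℝ) : ℍ[ℝ]) * X ^ 2 := by
  rw [kernInv, kernInv, star_star, one_sub_C_mul_X_mul_one_sub_C_mul_X,
    Quaternion.self_add_star', Quaternion.self_mul_star, Quaternion.normSq_eq_norm_mul_self, ← sq]

theorem sphKern_mul_kernInv_star_mul_kernInv (a : ℍ[ℝ]) :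
    sphKern a * (kernInv (star a) * kernInv a) = 1 := by
  rw [sphKern, mul_assoc, ← mul_assoc (kern (star a)), kern_mul_kernInv, one_mul,
    kern_mul_kernInv]

theorem sphKern_eq_of_mem {a b : ℍ[ℝ]} (h : b ∈ simClass a) : sphKern b = sphKern a := by
  obtain ⟨hre, hnorm⟩ := mem_simClass_iff.1 h
  have hden : kernInv (star b) * kernInv b = kernInv (star a) * kernInv a := by
    rw [kernInv_star_mul_kernInv, kernInv_star_mul_kernInv, hre, hnorm]
  have hb := sphKern_mul_kernInv_star_mul_kernInv b
  have ha := sphKern_mul_kernInv_star_mul_kernInv a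
  rw [hden] at hb
  exact mul_right_cancel₀ (right_ne_zero_of_mul_eq_one ha) (hb.trans ha.symm)

theorem sphBlaschke_eq_mul_star (a : ℍ[ℝ]) :
    sphBlaschke a = blaschke a * blaschke (star a) := by
  rw [sphBlaschke, sharp_blaschke]

theorem sphBlaschke_eq_sphPoly_mul_sphKern (a : ℍ[ℝ]) :
    sphBlaschke a = sphPoly a * sphKern a := by
  have hcomm : Commute (rho (star a)) (kern a) := commute_rho_kern rfl
  rw [sphBlaschke_eq_mul_star, blaschke, blaschke, mul_assoc, ← mul_assoc (kern a), ← hcomm.eq,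
    mul_assoc, ← mul_assoc, rho_mul_rho_star, sphKern]

theorem blaschke_mul_blaschke_star {a b : ℍ[ℝ]} (h : b ∈ simClass a) :
    blaschke b * blaschke (star b) = sphBlaschke a := by
  rw [← sphBlaschke_eq_mul_star, sphBlaschke_eq_sphPoly_mul_sphKern, sphPoly_eq_of_mem h,
    sphKern_eq_of_mem h, sphBlaschke_eq_sphPoly_mul_sphKern]

theorem sharp_sphBlaschke (a : ℍ[ℝ]) : sharp (sphBlaschke a) = sphBlaschke a :=
  sharp_mul_sharp_self _

theorem commute_sphBlaschke (a : ℍ[ℝ]) (f : QSeries) : Commute (sphBlaschke a) f :=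
  commute_of_sharp_eq (sharp_sphBlaschke a) f

theorem sphBlaschke_ne_zero (a : ℍ[ℝ]) : sphBlaschke a ≠ 0 := by
  rw [sphBlaschke_eq_mul_star]
  exact mul_ne_zero (blaschke_ne_zero _) (blaschke_ne_zero _)

/-! ### Products of Blaschke factors -/

/-- The product `b_{α₁} ⋯ b_{αₙ}` of the Blaschke factors of a list of points. -/
noncomputable def blaschkeProd (l : List ℍ[ℝ]) : QSeries := (l.map blaschke).prod

@[simp]
theorem blaschkeProd_nil : blaschkeProd [] = 1 := rfl

@[simp]
theorem blaschkeProd_cons (a : ℍ[ℝ]) (l : List ℍ[ℝ]) :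
    blaschkeProd (a :: l) = blaschke a * blaschkeProd l :=
  List.prod_cons

theorem blaschkeProd_append (l l' : List ℍ[ℝ]) :
    blaschkeProd (l ++ l') = blaschkeProd l * blaschkeProd l' := by
  rw [blaschkeProd, List.map_append, List.prod_append, blaschkeProd, blaschkeProd]

theorem sharp_blaschkeProd (l : List ℍ[ℝ]) :
    sharp (blaschkeProd l) = blaschkeProd (l.map star).reverse := by
  induction l with
  | nil => simp
  | cons a l ih =>
    rw [blaschkeProd_cons, sharp_mul, ih, sharp_blaschke, List.map_cons, List.reverse_cons,
      blaschkeProd_append, blaschkeProd_cons, blaschkeProd_nil, mul_one]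

theorem blaschkeProd_mul_sharp {a : ℍ[ℝ]} {l : List ℍ[ℝ]} (hl : ∀ b ∈ l, b ∈ simClass a) :
    blaschkeProd l * sharp (blaschkeProd l) = sphBlaschke a ^ l.length := by
  induction l with
  | nil => simp
  | cons b l ih =>
    rw [List.forall_mem_cons] at hl
    rw [blaschkeProd_cons, mul_sharp_mul, ih hl.2, sharp_blaschke,
      blaschke_mul_blaschke_star hl.1, List.length_cons, pow_succ']

/-! ### The Schur class through partial sums -/

section PartialNormSq

variable {R : Type*} [NormedRing R]

/-- The squared norm `∑_{k < n} ‖g_k‖²` of the section of length `n` of a power series, finite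
even where the Hardy norm is not. -/
noncomputable def partialNormSq (n : ℕ) (g : R⟦X⟧) : ℝ := ∑ k ∈ Finset.range n, ‖coeff k g‖ ^ 2

theorem partialNormSq_succ (n : ℕ) (g : R⟦X⟧) :
    partialNormSq (n + 1) g = partialNormSq n g + ‖coeff n g‖ ^ 2 :=
  Finset.sum_range_succ _ n

theorem partialNormSq_nonneg (n : ℕ) (g : R⟦X⟧) : 0 ≤ partialNormSq n g :=
  Finset.sum_nonneg fun _ _ => sq_nonneg _

theorem partialNormSq_mono (g : R⟦X⟧) : Monotone fun n => partialNormSq n g :=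
  monotone_nat_of_le_succ fun n => by
    rw [partialNormSq_succ]
    exact le_add_of_nonneg_right (sq_nonneg _)

theorem partialNormSq_congr {n : ℕ} {f g : R⟦X⟧} (h : ∀ k < n, coeff k f = coeff k g) :
    partialNormSq n f = partialNormSq n g :=
  Finset.sum_congr rfl fun k hk => by rw [h k (Finset.mem_range.1 hk)]

theorem partialNormSq_coe_trunc_le (m n : ℕ) (h : R⟦X⟧) :
    partialNormSq m (trunc n h : R⟦X⟧) ≤ partialNormSq n h := by
  rw [partialNormSq, partialNormSq, ← Finset.sum_filter_of_ne (p := (· < n))]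
  · refine (Finset.sum_congr rfl fun k hk => ?_).trans_le
      (Finset.sum_le_sum_of_subset_of_nonneg ?_ fun _ _ _ => sq_nonneg _)
    · rw [Polynomial.coeff_coe, coeff_trunc, if_pos (Finset.mem_filter.1 hk).2]
    · exact fun k hk => Finset.mem_range.2 (Finset.mem_filter.1 hk).2
  · intro k _ hk
    by_contra hkn
    simp [Polynomial.coeff_coe, coeff_trunc, hkn] at hk

theorem coeff_mul_coe_trunc {n k : ℕ} (hk : k < n) (f h : R⟦X⟧) :
    coeff k (f * (trunc n h : R⟦X⟧)) = coeff k (f * h) := by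
  rw [coeff_mul, coeff_mul]
  refine Finset.sum_congr rfl fun p hp => ?_
  have hlt : p.2 < n := (Finset.HasAntidiagonal.antidiagonal.snd_le hp).trans_lt hk
  rw [Polynomial.coeff_coe, coeff_trunc, if_pos hlt]

end PartialNormSq

theorem partialNormSq_one_le (n : ℕ) : partialNormSq n (1 : QSeries) ≤ 1 := by
  refine (partialNormSq_mono 1 n.le_succ).trans_eq ?_
  change partialNormSq (n + 1) 1 = 1
  rw [partialNormSq, Finset.sum_eq_single 0] <;> simp +contextual [coeff_one]

theorem hardyNormSq_eq_iSup (g : QSeries) :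
    hardyNormSq g = ⨆ n, ENNReal.ofReal (partialNormSq n g) := by
  rw [hardyNormSq, ENNReal.tsum_eq_iSup_nat]
  refine iSup_congr fun n => ?_
  rw [partialNormSq, ENNReal.ofReal_sum_of_nonneg fun _ _ => sq_nonneg _]
  exact Finset.sum_congr rfl fun k _ => by rw [ENNReal.ofReal_pow (norm_nonneg _), ofReal_norm]

theorem ofReal_partialNormSq_le_hardyNormSq (n : ℕ) (g : QSeries) :
    ENNReal.ofReal (partialNormSq n g) ≤ hardyNormSq g := by
  rw [hardyNormSq_eq_iSup]
  exact le_iSup (fun m => ENNReal.ofReal (partialNormSq m g)) n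

theorem hardyNormSq_coe_trunc_le (n : ℕ) (h : QSeries) :
    hardyNormSq (trunc n h : QSeries) ≤ ENNReal.ofReal (partialNormSq n h) := by
  rw [hardyNormSq_eq_iSup]
  exact iSup_le fun m => ENNReal.ofReal_le_ofReal (partialNormSq_coe_trunc_le m n h)

theorem IsSchur.partialNormSq_mul_le {f : QSeries} (hf : IsSchur f) (n : ℕ) (h : QSeries) :
    partialNormSq n (f * h) ≤ partialNormSq n h := by
  have htrunc := hardyNormSq_coe_trunc_le n h
  rw [← partialNormSq_congr fun k hk => coeff_mul_coe_trunc hk f h,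
    ← ENNReal.ofReal_le_ofReal_iff (partialNormSq_nonneg n h)]
  exact (ofReal_partialNormSq_le_hardyNormSq n _).trans
    ((hf _ (htrunc.trans_lt ENNReal.ofReal_lt_top)).trans htrunc)

theorem isSchur_iff {f : QSeries} :
    IsSchur f ↔ ∀ n h, partialNormSq n (f * h) ≤ partialNormSq n h := by
  refine ⟨IsSchur.partialNormSq_mul_le, fun hf h _ => ?_⟩
  rw [hardyNormSq_eq_iSup, hardyNormSq_eq_iSup]
  exact iSup_mono fun n => ENNReal.ofReal_le_ofReal (hf n h)

theorem IsSchur.partialNormSq_le_one {f : QSeries} (hf : IsSchur f) (n : ℕ) :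
    partialNormSq n f ≤ 1 := by
  simpa using (hf.partialNormSq_mul_le n 1).trans (partialNormSq_one_le n)

theorem IsSchur.norm_coeff_le_one {f : QSeries} (hf : IsSchur f) (k : ℕ) : ‖coeff k f‖ ≤ 1 := by
  have h := hf.partialNormSq_le_one (k + 1)
  rw [partialNormSq_succ] at h
  exact (sq_le_one_iff₀ (norm_nonneg _)).1 (by linarith [partialNormSq_nonneg k f])

theorem IsSchur.tendsto_coeff {f : QSeries} (hf : IsSchur f) :
    Tendsto (fun k => coeff k f) atTop (𝓝 0) := by
  have hsum : Summable fun k => ‖coeff k f‖ ^ 2 :=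
    summable_of_sum_range_le (fun _ => sq_nonneg _) hf.partialNormSq_le_one
  rw [tendsto_zero_iff_norm_tendsto_zero]
  simpa using hsum.tendsto_atTop_zero.sqrt

theorem coeff_mul_sharp (f g : QSeries) (n : ℕ) :
    coeff n (f * sharp g) = ∑ k ∈ Finset.range (n + 1), coeff (n - k) f * star (coeff k g) := by
  rw [coeff_mul, ← Finset.Nat.sum_antidiagonal_swap,
    Finset.Nat.sum_antidiagonal_eq_sum_range_succ_mk]
  simp only [Prod.swap_prod_mk, coeff_sharp]

theorem two_mul_re_coeff_mul_sharp_le (f g : QSeries) (n : ℕ) :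
    2 * (coeff n (f * sharp g)).re ≤ partialNormSq (n + 1) f + partialNormSq (n + 1) g := by
  rw [coeff_mul_sharp, re_sum, partialNormSq, partialNormSq,
    ← Finset.sum_range_reflect (fun k => ‖coeff k f‖ ^ 2), ← Finset.sum_add_distrib, Finset.mul_sum]
  refine Finset.sum_le_sum fun k _ => ?_
  rw [← Quaternion.inner_def, Nat.add_sub_cancel]
  have hinner := real_inner_le_norm (coeff (n - k) f) (coeff k g)
  linarith [two_mul_le_add_sq ‖coeff (n - k) f‖ ‖coeff k g‖]

/-- The Toeplitz matrix of `f♯` is the adjoint of that of `f` up to reversing the order of the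
coefficients; hence the reversal `y'` of `y = f♯ h`, for which
`‖y‖² = Re (y' y♯)_n = Re (f y' h♯)_n ≤ (‖y‖² + ‖h‖²) / 2`. -/
theorem IsSchur.sharp {f : QSeries} (hf : IsSchur f) : IsSchur (sharp f) := by
  refine isSchur_iff.2 fun n h => ?_
  cases n with
  | zero => simp [partialNormSq]
  | succ n =>
    set y := QSchur.sharp f * h with hy
    let y' : QSeries := PowerSeries.mk fun i => coeff (n - i) y
    have hreflect : partialNormSq (n + 1) y' = partialNormSq (n + 1) y := by
      rw [partialNormSq, partialNormSq, ← Finset.sum_range_reflect]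
      refine Finset.sum_congr rfl fun k hk => ?_
      rw [coeff_mk, Nat.add_sub_cancel,
        Nat.sub_sub_self (Nat.le_of_lt_succ (Finset.mem_range.1 hk))]
    have hself : partialNormSq (n + 1) y = (coeff n (y' * QSchur.sharp y)).re := by
      rw [coeff_mul_sharp, re_sum]
      refine Finset.sum_congr rfl fun k hk => ?_
      rw [coeff_mk, Nat.sub_sub_self (Nat.le_of_lt_succ (Finset.mem_range.1 hk)),
        ← Quaternion.inner_def, real_inner_self_eq_norm_sq]
    have hadjoint : (coeff n (y' * QSchur.sharp y)).re
        = (coeff n (f * y' * QSchur.sharp h)).re := by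
      rw [hy, sharp_mul, sharp_sharp, ← mul_assoc, re_coeff_mul_comm, ← mul_assoc]
    have hpair := two_mul_re_coeff_mul_sharp_le (f * y') h n
    linarith [hf.partialNormSq_mul_le (n + 1) y']

/-! ### Series converging in the unit ball -/

section ConvergesInBall

variable {R : Type*} [NormedRing R] {f g : R⟦X⟧}

/-- Absolute convergence in the open unit ball, an explicit form of membership in `ℋ₁`. -/
def ConvergesInBall (f : R⟦X⟧) : Prop :=
  ∀ r : ℝ, 0 ≤ r → r < 1 → Summable fun k => ‖coeff k f‖ * r ^ k

theorem convergesInBall_of_eventually_le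
    (h : ∀ r : ℝ, 0 ≤ r → r < 1 → ∃ s > r, ∃ M : ℝ, ∀ᶠ k in atTop, ‖coeff k f‖ * s ^ k ≤ M) :
    ConvergesInBall f := fun r hr0 hr1 => by
  obtain ⟨s, hrs, M, hM⟩ := h r hr0 hr1
  have hs0 : 0 < s := hr0.trans_lt hrs
  have hgeom : Summable fun k : ℕ => M * (r / s) ^ k :=
    (summable_geometric_of_lt_one (by positivity) ((div_lt_one hs0).2 hrs)).mul_left M
  refine hgeom.of_norm_bounded_eventually_nat (hM.mono fun k hk => ?_)
  calc ‖‖coeff k f‖ * r ^ k‖ = ‖coeff k f‖ * s ^ k * (r / s) ^ k := by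
        rw [Real.norm_of_nonneg (by positivity), div_pow]
        field_simp
    _ ≤ M * (r / s) ^ k := by gcongr

theorem convergesInBall_of_norm_coeff_le {M : ℝ} (h : ∀ k, ‖coeff k f‖ ≤ M) :
    ConvergesInBall f :=
  convergesInBall_of_eventually_le fun _ _ hr1 =>
    ⟨1, hr1, M, Eventually.of_forall fun k => by simpa using h k⟩

theorem convergesInBall_C (a : R) : ConvergesInBall (C a) :=
  convergesInBall_of_norm_coeff_le (M := ‖a‖) fun k => by
    rw [coeff_C]
    split_ifs <;> simp

theorem convergesInBall_one : ConvergesInBall (1 : R⟦X⟧) := by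
  simpa using convergesInBall_C (1 : R)

theorem convergesInBall_X : ConvergesInBall (X : R⟦X⟧) :=
  convergesInBall_of_norm_coeff_le (M := ‖(1 : R)‖) fun k => by
    rw [coeff_X]
    split_ifs <;> simp

theorem ConvergesInBall.sub (hf : ConvergesInBall f) (hg : ConvergesInBall g) :
    ConvergesInBall (f - g) := fun r hr0 hr1 =>
  ((hf r hr0 hr1).add (hg r hr0 hr1)).of_nonneg_of_le (fun k => by positivity) fun k => by
    rw [map_sub, ← add_mul]
    gcongr
    exact norm_sub_le _ _

theorem ConvergesInBall.mul (hf : ConvergesInBall f) (hg : ConvergesInBall g) :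
    ConvergesInBall (f * g) := fun r hr0 hr1 => by
  refine (summable_norm_sum_mul_antidiagonal_of_summable_norm
    (hf r hr0 hr1).norm (hg r hr0 hr1).norm).of_nonneg_of_le (fun k => by positivity) fun k => ?_
  calc ‖coeff k (f * g)‖ * r ^ k
      ≤ (∑ p ∈ Finset.HasAntidiagonal.antidiagonal k, ‖coeff p.1 f‖ * ‖coeff p.2 g‖) * r ^ k := by
        rw [coeff_mul]
        gcongr
        exact (norm_sum_le _ _).trans (Finset.sum_le_sum fun p _ => norm_mul_le _ _)
    _ = ∑ p ∈ Finset.HasAntidiagonal.antidiagonal k,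
          ‖coeff p.1 f‖ * r ^ p.1 * (‖coeff p.2 g‖ * r ^ p.2) := by
        rw [Finset.sum_mul]
        refine Finset.sum_congr rfl fun p hp => ?_
        rw [← Finset.HasAntidiagonal.mem_antidiagonal.1 hp, pow_add]
        ring
    _ ≤ _ := le_abs_self _

theorem ConvergesInBall.pow (hf : ConvergesInBall f) (n : ℕ) : ConvergesInBall (f ^ n) := by
  induction n with
  | zero => simpa using convergesInBall_one
  | succ n ih =>
    rw [pow_succ]
    exact ih.mul hf

end ConvergesInBall

theorem enorm_rpow_one_div_le_ofReal_iff {E : Type*} [SeminormedAddCommGroup E] {x : E} {t : ℝ}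
    (ht : 0 ≤ t) {k : ℕ} (hk : k ≠ 0) :
    ‖x‖ₑ ^ (1 / (k : ℝ)) ≤ ENNReal.ofReal t ↔ ‖x‖ ≤ t ^ k := by
  rw [one_div, ENNReal.rpow_inv_le_iff (by positivity), ENNReal.rpow_natCast,
    ← ENNReal.ofReal_pow ht, ← ofReal_norm, ENNReal.ofReal_le_ofReal_iff (by positivity)]

theorem InH1.convergesInBall {f : QSeries} (hf : InH1 f) : ConvergesInBall f := by
  refine convergesInBall_of_eventually_le fun r hr0 hr1 => ?_
  obtain ⟨s, hrs, hs1⟩ := exists_between hr1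
  have hs0 : 0 < s := hr0.trans_lt hrs
  have hlt : (1 : ℝ≥0∞) < ENNReal.ofReal s⁻¹ :=
    ENNReal.one_lt_ofReal.2 ((one_lt_inv₀ hs0).2 hs1)
  refine ⟨s, hrs, 1, ?_⟩
  filter_upwards [eventually_lt_of_limsup_lt (hf.trans_lt hlt), eventually_ne_atTop 0] with k hk hk0
  have hroot := (enorm_rpow_one_div_le_ofReal_iff (by positivity) hk0).1 hk.le
  rwa [inv_pow, ← one_div, le_div_iff₀ (by positivity)] at hroot

theorem ConvergesInBall.inH1 {f : QSeries} (hf : ConvergesInBall f) : InH1 f := by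
  refine ENNReal.le_of_forall_pos_le_add fun ε hε _ => ?_
  have ht : (1 : ℝ) < 1 + ε := by simpa using hε
  have htends := (hf (1 + ε)⁻¹ (by positivity) (inv_lt_one_of_one_lt₀ ht)).tendsto_atTop_zero
  refine limsup_le_of_le (by isBoundedDefault) ?_
  filter_upwards [htends.eventually_le_const one_pos, eventually_ne_atTop 0] with k hk hk0
  rw [inv_pow, ← div_eq_mul_inv, div_le_one (by positivity)] at hk
  rw [← ENNReal.ofReal_one, ← ENNReal.ofReal_coe_nnreal,
    ← ENNReal.ofReal_add zero_le_one ε.coe_nonneg]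
  exact (enorm_rpow_one_div_le_ofReal_iff (by positivity) hk0).2 hk

theorem inH1_iff_convergesInBall {f : QSeries} : InH1 f ↔ ConvergesInBall f :=
  ⟨InH1.convergesInBall, ConvergesInBall.inH1⟩

theorem IsSchur.convergesInBall {f : QSeries} (hf : IsSchur f) : ConvergesInBall f :=
  convergesInBall_of_norm_coeff_le hf.norm_coeff_le_one

theorem ConvergesInBall.sharp {f : QSeries} (hf : ConvergesInBall f) :
    ConvergesInBall (sharp f) := fun r hr0 hr1 => by
  simpa using hf r hr0 hr1

theorem convergesInBall_rho (a : ℍ[ℝ]) : ConvergesInBall (rho a) :=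
  convergesInBall_X.sub (convergesInBall_C a)

theorem convergesInBall_sphPoly (a : ℍ[ℝ]) : ConvergesInBall (sphPoly a) := by
  rw [← rho_mul_rho_star]
  exact (convergesInBall_rho _).mul (convergesInBall_rho _)

section

variable {a : ℍ[ℝ]} (ha : ‖a‖ < 1)
include ha

theorem convergesInBall_kern : ConvergesInBall (kern a) :=
  convergesInBall_of_norm_coeff_le (M := 1) fun k => by
    simpa [kern] using pow_le_one₀ (norm_nonneg a) ha.le

theorem convergesInBall_blaschke : ConvergesInBall (blaschke a) :=
  (convergesInBall_rho a).mul (convergesInBall_kern ha)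

theorem convergesInBall_sphKern : ConvergesInBall (sphKern a) :=
  (convergesInBall_kern ha).mul (convergesInBall_kern (by simpa using ha))

end

theorem convergesInBall_blaschkeProd {l : List ℍ[ℝ]} (hl : ∀ a ∈ l, ‖a‖ < 1) :
    ConvergesInBall (blaschkeProd l) := by
  induction l with
  | nil => exact convergesInBall_one
  | cons a l ih =>
    rw [List.forall_mem_cons] at hl
    exact (convergesInBall_blaschke hl.1).mul (ih hl.2)

/-! ### Left evaluation and left division -/

section Evaluation

variable {f g : QSeries} {γ : ℍ[ℝ]}

theorem leftEval_sharp (f : QSeries) (γ : ℍ[ℝ]) :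
    leftEval (sharp f) γ = star (rightEval f (star γ)) := by
  rw [leftEval, rightEval, tsum_star]
  simp

theorem isRightZero_iff_isLeftZero_sharp : IsRightZero f γ ↔ IsLeftZero (sharp f) (star γ) := by
  rw [IsRightZero, IsLeftZero, leftEval_sharp, star_star, Quaternion.norm_star, star_eq_zero]

theorem leftEval_C (c γ : ℍ[ℝ]) : leftEval (C c) γ = c := by
  rw [leftEval, tsum_eq_single 0] <;> simp +contextual [coeff_C]

theorem leftEval_C_mul_of_semiconjBy {c δ : ℍ[ℝ]} (h : SemiconjBy c δ γ) (g : QSeries) :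
    leftEval (C c * g) γ = c * leftEval g δ := by
  rw [leftEval, leftEval, ← tsum_mul_left]
  refine tsum_congr fun k => ?_
  rw [coeff_C_mul, ← mul_assoc, ← mul_assoc, (h.pow_right k).eq]

theorem leftEval_mul_C (g : QSeries) (c γ : ℍ[ℝ]) : leftEval (g * C c) γ = leftEval g γ * c := by
  rw [leftEval, leftEval, ← tsum_mul_right]
  simp only [coeff_mul_C, mul_assoc]

theorem norm_pow_mul_coeff_le (f : QSeries) {t : ℝ} (ht : 0 < t) (hγt : ‖γ‖ ≤ t) (m j : ℕ) :
    ‖γ ^ j * coeff (m + j) f‖ ≤ ‖coeff (m + j) f‖ * t ^ (m + j) / t ^ m := by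
  rw [norm_mul, norm_pow, pow_add, mul_left_comm, mul_div_cancel_left₀ _ (pow_pos ht m).ne',
    mul_comm]
  gcongr

theorem ConvergesInBall.summable_add (hf : ConvergesInBall f) (hγ : ‖γ‖ < 1) (m : ℕ) :
    Summable fun j => γ ^ j * coeff (m + j) f := by
  obtain ⟨t, hγt, ht1⟩ := exists_between hγ
  have ht0 : 0 < t := (norm_nonneg γ).trans_lt hγt
  have hsum := (summable_nat_add_iff m).2 (hf t ht0.le ht1)
  refine Summable.of_norm_bounded (hsum.div_const (t ^ m)) fun j => ?_
  rw [add_comm j m]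
  exact norm_pow_mul_coeff_le f ht0 hγt.le m j

theorem ConvergesInBall.summable (hf : ConvergesInBall f) (hγ : ‖γ‖ < 1) :
    Summable fun k => γ ^ k * coeff k f := by
  simpa using hf.summable_add hγ 0

theorem leftEval_add (hf : ConvergesInBall f) (hg : ConvergesInBall g) (hγ : ‖γ‖ < 1) :
    leftEval (f + g) γ = leftEval f γ + leftEval g γ := by
  rw [leftEval, leftEval, leftEval, ← (hf.summable hγ).tsum_add (hg.summable hγ)]
  simp [mul_add]

theorem leftEval_sub (hf : ConvergesInBall f) (hg : ConvergesInBall g) (hγ : ‖γ‖ < 1) :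
    leftEval (f - g) γ = leftEval f γ - leftEval g γ := by
  rw [leftEval, leftEval, leftEval, ← (hf.summable hγ).tsum_sub (hg.summable hγ)]
  simp [mul_sub]

theorem leftEval_X_mul (hg : ConvergesInBall g) (hγ : ‖γ‖ < 1) :
    leftEval (X * g) γ = γ * leftEval g γ := by
  rw [leftEval, ((convergesInBall_X.mul hg).summable hγ).tsum_eq_zero_add, leftEval,
    ← tsum_mul_left]
  simp [coeff_succ_X_mul, pow_succ', mul_assoc]

theorem leftEval_rho_mul_self (hg : ConvergesInBall g) (hγ : ‖γ‖ < 1) :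
    leftEval (rho γ * g) γ = 0 := by
  rw [rho, sub_mul, leftEval_sub (convergesInBall_X.mul hg) ((convergesInBall_C γ).mul hg) hγ,
    leftEval_X_mul hg hγ, leftEval_C_mul_of_semiconjBy (Commute.refl γ), sub_self]

/-- The quotient `∑_k (∑_j γ^j f_{k+1+j}) z^k` of the division of `f` on the left by `z - γ`, with
remainder `leftEval f γ`. -/
noncomputable def leftQuot (f : QSeries) (γ : ℍ[ℝ]) : QSeries :=
  PowerSeries.mk fun k => ∑' j, γ ^ j * coeff (k + 1 + j) f

theorem eq_leftEval_add_rho_mul_leftQuot (hf : ConvergesInBall f) (hγ : ‖γ‖ < 1) :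
    f = C (leftEval f γ) + rho γ * leftQuot f γ := by
  have hstep (m : ℕ) : ∑' j, γ ^ j * coeff (m + j) f
      = coeff m f + γ * ∑' j, γ ^ j * coeff (m + 1 + j) f := by
    rw [(hf.summable_add hγ m).tsum_eq_zero_add, ← tsum_mul_left]
    simp [pow_succ', mul_assoc, add_comm, add_left_comm]
  ext1 k
  rw [rho, sub_mul, map_add, map_sub, coeff_C_mul]
  cases k with
  | zero =>
    have hzero := hstep 0
    simp only [zero_add] at hzero
    simp [leftQuot, leftEval, hzero]
  | succ k => simp [leftQuot, coeff_succ_X_mul, hstep (k + 1)]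

theorem convergesInBall_leftQuot (hf : ConvergesInBall f) (hγ : ‖γ‖ < 1) :
    ConvergesInBall (leftQuot f γ) := by
  refine convergesInBall_of_eventually_le fun r hr0 hr1 => ?_
  obtain ⟨t, hmax, ht1⟩ := exists_between (max_lt hγ hr1)
  obtain ⟨hγt, hrt⟩ := max_lt_iff.1 hmax
  have ht0 : 0 < t := hr0.trans_lt hrt
  have hsum := hf t ht0.le ht1
  set S := ∑' m, ‖coeff m f‖ * t ^ m
  refine ⟨t, hrt, S / t, Eventually.of_forall fun k => ?_⟩
  have htail : ∑' j, ‖coeff (k + 1 + j) f‖ * t ^ (k + 1 + j) ≤ S :=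
    tsum_comp_le_tsum_of_inj hsum (fun m => by positivity) (add_right_injective (k + 1))
  have hbound : ‖coeff k (leftQuot f γ)‖ ≤ S / t ^ (k + 1) := by
    rw [leftQuot, coeff_mk]
    refine (tsum_of_norm_bounded ((hsum.comp_injective
      (add_right_injective (k + 1))).hasSum.div_const (t ^ (k + 1)))
      (norm_pow_mul_coeff_le f ht0 hγt.le (k + 1))).trans ?_
    gcongr
    exact htail
  calc ‖coeff k (leftQuot f γ)‖ * t ^ k ≤ S / t ^ (k + 1) * t ^ k := by gcongr
    _ = S / t := by
      rw [pow_succ']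
      field_simp

theorem IsLeftZero.eq_rho_mul_leftQuot (h : IsLeftZero f γ) (hf : ConvergesInBall f) :
    f = rho γ * leftQuot f γ := by
  simpa [h.2] using eq_leftEval_add_rho_mul_leftQuot hf h.1

theorem leftEval_mul_of_semiconjBy (hf : ConvergesInBall f) (hg : ConvergesInBall g)
    (hγ : ‖γ‖ < 1) {δ : ℍ[ℝ]} (h : SemiconjBy (leftEval f γ) δ γ) :
    leftEval (f * g) γ = leftEval f γ * leftEval g δ := by
  have hq := (convergesInBall_leftQuot hf hγ).mul hg
  have hfg : f * g = C (leftEval f γ) * g + rho γ * (leftQuot f γ * g) := by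
    conv_lhs => rw [eq_leftEval_add_rho_mul_leftQuot hf hγ]
    rw [add_mul, mul_assoc]
  rw [hfg, leftEval_add ((convergesInBall_C _).mul hg) ((convergesInBall_rho _).mul hq) hγ,
    leftEval_rho_mul_self hq hγ, add_zero, leftEval_C_mul_of_semiconjBy h]

theorem leftEval_mul_of_eq_zero (hf : ConvergesInBall f) (hg : ConvergesInBall g) (hγ : ‖γ‖ < 1)
    (h : leftEval f γ = 0) : leftEval (f * g) γ = 0 := by
  rw [leftEval_mul_of_semiconjBy hf hg hγ (δ := γ) (by simp [h]), h, zero_mul]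

theorem leftEval_mul_eq_zero (hf : ConvergesInBall f) (hg : ConvergesInBall g) (hγ : ‖γ‖ < 1)
    (h : leftEval (f * g) γ = 0) : leftEval f γ = 0 ∨ ∃ β ∈ simClass γ, leftEval g β = 0 := by
  by_cases h0 : leftEval f γ = 0
  · exact Or.inl h0
  · have hsemi : SemiconjBy (leftEval f γ) ((leftEval f γ)⁻¹ * γ * leftEval f γ) γ := by
      rw [SemiconjBy, ← mul_assoc, mul_inv_cancel_left₀ h0]
    rw [leftEval_mul_of_semiconjBy hf hg hγ hsemi, mul_eq_zero] at h
    exact Or.inr ⟨_, inv_mul_mul_mem_simClass γ h0, h.resolve_left h0⟩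

end Evaluation

/-! ### Division of a Schur series by a Blaschke factor -/

theorem coeff_zero_rho_mul (a : ℍ[ℝ]) (w : QSeries) :
    coeff 0 (rho a * w) = -(a * coeff 0 w) := by
  rw [rho, sub_mul, map_sub, coeff_C_mul, coeff_zero_X_mul, zero_sub]

theorem coeff_succ_rho_mul (a : ℍ[ℝ]) (w : QSeries) (n : ℕ) :
    coeff (n + 1) (rho a * w) = coeff n w - a * coeff (n + 1) w := by
  rw [rho, sub_mul, map_sub, coeff_C_mul, coeff_succ_X_mul]

theorem coeff_zero_kernInv_mul (a : ℍ[ℝ]) (w : QSeries) :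
    coeff 0 (kernInv a * w) = coeff 0 w := by
  rw [kernInv, sub_mul, mul_assoc, map_sub, coeff_C_mul, coeff_zero_X_mul, one_mul, mul_zero,
    sub_zero]

theorem coeff_succ_kernInv_mul (a : ℍ[ℝ]) (w : QSeries) (n : ℕ) :
    coeff (n + 1) (kernInv a * w) = coeff (n + 1) w - star a * coeff n w := by
  rw [kernInv, sub_mul, mul_assoc, map_sub, coeff_C_mul, coeff_succ_X_mul, one_mul]

theorem inner_star_mul_right (a v w : ℍ[ℝ]) : inner ℝ w (star a * v) = inner ℝ v (a * w) := by
  rw [Quaternion.inner_def, real_inner_comm, Quaternion.inner_def, star_mul, star_star, ← mul_assoc,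
    re_mul_comm, mul_assoc, ← mul_assoc, re_mul_comm]

/-- For `a ∈ 𝔻` the isometry property of `b_a`, with the defect of the truncation made explicit. -/
theorem partialNormSq_kernInv_mul (a : ℍ[ℝ]) (w : QSeries) (n : ℕ) :
    partialNormSq (n + 1) (kernInv a * w)
      = partialNormSq (n + 1) (rho a * w) + (1 - ‖a‖ ^ 2) * ‖coeff n w‖ ^ 2 := by
  induction n with
  | zero =>
    simp only [partialNormSq, zero_add, Finset.sum_range_one, coeff_zero_kernInv_mul,
      coeff_zero_rho_mul, norm_neg, norm_mul]
    ring
  | succ n ih =>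
    rw [partialNormSq_succ, ih, partialNormSq_succ (n + 1), coeff_succ_kernInv_mul,
      coeff_succ_rho_mul, norm_sub_sq_real, norm_sub_sq_real, inner_star_mul_right,
      norm_mul, norm_mul, norm_star]
    ring

theorem tendsto_coeff_mul_coe {R : Type*} [NormedRing R] {u : R⟦X⟧}
    (hu : Tendsto (fun k => coeff k u) atTop (𝓝 0)) (p : Polynomial R) :
    Tendsto (fun k => coeff k (u * (p : R⟦X⟧))) atTop (𝓝 0) := by
  induction p using Polynomial.induction_on' with
  | add p q hp hq => simpa [mul_add] using hp.add hq
  | monomial n a =>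
    rw [← tendsto_add_atTop_iff_nat n, ← Polynomial.C_mul_X_pow_eq_monomial]
    simpa [← mul_assoc, coeff_mul_X_pow, coeff_mul_C] using hu.mul_const a

theorem IsSchur.tendsto_coeff_leftQuot {f : QSeries} (hf : IsSchur f) {a : ℍ[ℝ]} (ha : ‖a‖ < 1) :
    Tendsto (fun k => coeff k (leftQuot f a)) atTop (𝓝 0) := by
  have hcoeff (j : ℕ) : Tendsto (fun k => coeff (k + 1 + j) f) atTop (𝓝 0) := by
    simpa only [add_assoc, Function.comp_def] using
      hf.tendsto_coeff.comp (tendsto_add_atTop_nat (1 + j))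
  have hterm (j : ℕ) : Tendsto (fun k => a ^ j * coeff (k + 1 + j) f) atTop (𝓝 0) := by
    simpa using (hcoeff j).const_mul (a ^ j)
  have hbound (k j : ℕ) : ‖a ^ j * coeff (k + 1 + j) f‖ ≤ ‖a‖ ^ j := by
    rw [norm_mul, norm_pow]
    exact mul_le_of_le_one_right (by positivity) (hf.norm_coeff_le_one _)
  simpa [leftQuot] using tendsto_tsum_of_dominated_convergence
    (summable_geometric_of_lt_one (norm_nonneg a) ha) hterm (Eventually.of_forall hbound)

theorem IsSchur.exists_eq_blaschke_mul {f : QSeries} (hf : IsSchur f) {a : ℍ[ℝ]}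
    (h : IsLeftZero f a) : ∃ H, IsSchur H ∧ f = blaschke a * H := by
  have hdiv : f = rho a * leftQuot f a := h.eq_rho_mul_leftQuot hf.convergesInBall
  refine ⟨kernInv a * leftQuot f a, isSchur_iff.2 fun n g => ?_, ?_⟩
  · have hdefect : Tendsto (fun M => partialNormSq n g
        + ‖coeff M (leftQuot f a * (trunc n g : QSeries))‖ ^ 2) atTop (𝓝 (partialNormSq n g)) := by
      simpa using ((tendsto_coeff_mul_coe (hf.tendsto_coeff_leftQuot h.1)
        (trunc n g)).norm.pow 2).const_add (partialNormSq n g)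
    refine ge_of_tendsto hdefect ?_
    filter_upwards [eventually_ge_atTop n] with M hM
    calc partialNormSq n (kernInv a * leftQuot f a * g)
        = partialNormSq n (kernInv a * leftQuot f a * (trunc n g : QSeries)) :=
          (partialNormSq_congr fun k hk => coeff_mul_coe_trunc hk _ g).symm
      _ ≤ partialNormSq (M + 1) (kernInv a * leftQuot f a * (trunc n g : QSeries)) :=
          partialNormSq_mono _ (by lia)
      _ = partialNormSq (M + 1) (f * (trunc n g : QSeries))
          + (1 - ‖a‖ ^ 2) * ‖coeff M (leftQuot f a * (trunc n g : QSeries))‖ ^ 2 := by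
          rw [mul_assoc, partialNormSq_kernInv_mul, ← mul_assoc, ← hdiv]
      _ ≤ _ := by
          gcongr
          · exact (hf.partialNormSq_mul_le _ _).trans (partialNormSq_coe_trunc_le _ n g)
          · exact mul_le_of_le_one_left (sq_nonneg _) (sub_le_self 1 (sq_nonneg _))
  · rw [blaschke_mul_kernInv_mul, ← hdiv]

/-! ### Zeros in a similarity class -/

theorem IsZero.norm_lt_one {f : QSeries} {γ : ℍ[ℝ]} (h : IsZero f γ) : ‖γ‖ < 1 :=
  h.elim And.left And.left

theorem isLeftZero_sharp_iff {f : QSeries} {γ : ℍ[ℝ]} :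
    IsLeftZero (sharp f) γ ↔ IsRightZero f (star γ) := by
  rw [isRightZero_iff_isLeftZero_sharp, star_star]

theorem isZero_sharp_iff {f : QSeries} {γ : ℍ[ℝ]} : IsZero (sharp f) γ ↔ IsZero f (star γ) := by
  rw [IsZero, IsZero, isLeftZero_sharp_iff, isRightZero_iff_isLeftZero_sharp (f := sharp f),
    sharp_sharp, or_comm]

theorem NoZerosIn.sharp {f : QSeries} {a : ℍ[ℝ]} (h : NoZerosIn f (simClass a)) :
    NoZerosIn (sharp f) (simClass a) := fun _ hγ h0 =>
  h _ (star_mem_simClass.2 hγ) (isZero_sharp_iff.1 h0)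

theorem leftEval_sharp_coe (f : QSeries) (x : ℝ) :
    leftEval (sharp f) (x : ℍ[ℝ]) = star (leftEval f (x : ℍ[ℝ])) := by
  rw [leftEval_sharp, Quaternion.star_coe, leftEval, rightEval]
  congr! 3 with k
  exact ((Quaternion.coe_commute x (coeff k f)).pow_left k).eq.symm

theorem leftEval_eq_zero_of_mem_simClass {g : QSeries} (hg : sharp g = g) {β γ : ℍ[ℝ]}
    (hβ : β ∈ simClass γ) (h : leftEval g γ = 0) : leftEval g β = 0 := by
  obtain ⟨c, hc, rfl⟩ := hβ
  have hsemi : SemiconjBy c γ (c * γ * c⁻¹) := (inv_mul_cancel_right₀ hc (c * γ)).symm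
  have hmul : leftEval g (c * γ * c⁻¹) * c = 0 := by
    rw [← leftEval_mul_C, (commute_of_sharp_eq hg (C c)).eq, leftEval_C_mul_of_semiconjBy hsemi, h,
      mul_zero]
  exact (mul_eq_zero.1 hmul).resolve_right hc

theorem commute_leftEval {f : QSeries} {γ : ℍ[ℝ]} (h : ∀ k, Commute γ (coeff k f)) :
    Commute γ (leftEval f γ) :=
  Commute.tsum_right γ fun k => ((Commute.refl γ).pow_right k).mul_right (h k)

theorem leftEval_mul_of_sharp_eq {f g : QSeries} (hs : sharp f = f) (hf : ConvergesInBall f)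
    (hg : ConvergesInBall g) {γ : ℍ[ℝ]} (hγ : ‖γ‖ < 1) :
    leftEval (f * g) γ = leftEval f γ * leftEval g γ :=
  leftEval_mul_of_semiconjBy hf hg hγ <| (commute_leftEval fun k => by
    rw [coeff_eq_re_of_sharp_eq hs]
    exact (Quaternion.coe_commute _ γ).symm).symm

theorem leftEval_rho (b γ : ℍ[ℝ]) : leftEval (rho b) γ = γ - b := by
  rw [leftEval, tsum_eq_sum (s := Finset.range 2)]
  · simp [Finset.sum_range_succ, rho, coeff_C, coeff_X, neg_add_eq_sub]
  · intro k hk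
    obtain ⟨h0, h1⟩ : k ≠ 0 ∧ k ≠ 1 := by grind
    simp [rho, coeff_C, coeff_X, h0, h1]

section SimClass

variable {f g : QSeries} {a b β γ : ℍ[ℝ]} (ha : ‖a‖ < 1)
include ha

theorem norm_lt_one_of_mem_simClass (hβ : β ∈ simClass a) : ‖β‖ < 1 := by
  rwa [norm_eq_of_mem_simClass hβ]

theorem leftEval_rho_mul (hβ : β ∈ simClass a) (hγ : γ ∈ simClass a) (hg : ConvergesInBall g) :
    leftEval (rho β * g) γ = (γ - β) * leftEval g (star β) := by
  obtain ⟨hre, hnorm⟩ := mem_simClass_iff.1 (simClass_eq_of_mem (star_mem_simClass.2 hβ) ▸ hγ)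
  have hsemi := semiconjBy_sub_star hre hnorm
  rw [star_star, ← leftEval_rho] at hsemi
  rw [leftEval_mul_of_semiconjBy (convergesInBall_rho β) hg (norm_lt_one_of_mem_simClass ha hγ)
    hsemi, leftEval_rho]

theorem exists_eq_sphPoly_mul (hf : ConvergesInBall f) (hβ : β ∈ simClass a) (hγ : γ ∈ simClass a)
    (hne : β ≠ γ) (hfβ : leftEval f β = 0) (hfγ : leftEval f γ = 0) :
    ∃ g, ConvergesInBall g ∧ f = sphPoly a * g := by
  have hβ1 := norm_lt_one_of_mem_simClass ha hβ
  have hu := convergesInBall_leftQuot hf hβ1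
  have hfu := IsLeftZero.eq_rho_mul_leftQuot ⟨hβ1, hfβ⟩ hf
  rw [hfu, leftEval_rho_mul ha hβ hγ hu, mul_eq_zero, sub_eq_zero] at hfγ
  have hβ1' : ‖star β‖ < 1 := by simpa using hβ1
  refine ⟨_, convergesInBall_leftQuot hu hβ1', ?_⟩
  rw [← sphPoly_eq_of_mem hβ, ← rho_mul_rho_star, mul_assoc,
    ← IsLeftZero.eq_rho_mul_leftQuot ⟨hβ1', hfγ.resolve_left hne.symm⟩ hu]
  exact hfu

theorem leftEval_sphPoly_mul (hg : ConvergesInBall g) (hγ : γ ∈ simClass a) :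
    leftEval (sphPoly a * g) γ = 0 := by
  rw [← sphPoly_eq_of_mem hγ, ← rho_mul_rho_star, mul_assoc]
  exact leftEval_rho_mul_self ((convergesInBall_rho _).mul hg) (norm_lt_one_of_mem_simClass ha hγ)

theorem isSphericalZero_iff (hre : ∀ x : ℝ, a ≠ x) (hf : ConvergesInBall f) :
    IsSphericalZero f (simClass a) ↔ ∃ g, ConvergesInBall g ∧ f = sphPoly a * g := by
  constructor
  · rintro (⟨β, hβ, γ, hγ, hne, hfβ, hfγ⟩ | ⟨β, hβ, γ, hγ, hne, hfβ, hfγ⟩)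
    · exact exists_eq_sphPoly_mul ha hf hβ hγ hne hfβ.2 hfγ.2
    · rw [isRightZero_iff_isLeftZero_sharp] at hfβ hfγ
      obtain ⟨g, hg, hfg⟩ := exists_eq_sphPoly_mul ha hf.sharp (star_mem_simClass.2 hβ)
        (star_mem_simClass.2 hγ) (star_injective.ne hne) hfβ.2 hfγ.2
      refine ⟨sharp g, hg.sharp, ?_⟩
      rw [← sharp_sharp f, hfg, sharp_mul, sharp_sphPoly, (commute_sphPoly a _).eq]
  · rintro ⟨g, hg, rfl⟩
    have hself := self_mem_simClass a
    have hstar := star_mem_simClass.2 hself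
    exact Or.inl ⟨a, hself, star a, hstar, fun h => hre _ (Quaternion.star_eq_self.1 h.symm),
      ⟨ha, leftEval_sphPoly_mul ha hg hself⟩,
      ⟨norm_lt_one_of_mem_simClass ha hstar, leftEval_sphPoly_mul ha hg hstar⟩⟩

theorem leftEval_eq_zero_of_forall_sharp (hf : ConvergesInBall f)
    (h : ∀ γ ∈ simClass a, leftEval (sharp f) γ = 0) : leftEval f a = 0 := by
  have hself := self_mem_simClass a
  by_cases hre : ∃ x : ℝ, a = x
  · obtain ⟨x, rfl⟩ := hre
    rw [← sharp_sharp f, leftEval_sharp_coe, h _ hself, star_zero]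
  · have hstar := star_mem_simClass.2 hself
    obtain ⟨g, hg, hfg⟩ := exists_eq_sphPoly_mul ha hf.sharp hself hstar
      (fun hne => hre ⟨_, Quaternion.star_eq_self.1 hne.symm⟩) (h _ hself) (h _ hstar)
    rw [← sharp_sharp f, hfg, sharp_mul, sharp_sphPoly, ← (commute_sphPoly a _).eq]
    exact leftEval_sphPoly_mul ha hg.sharp hself

theorem exists_leftEval_eq_zero_of_mul_sharp (hf : ConvergesInBall f)
    (h : leftEval (f * sharp f) a = 0) : ∃ β ∈ simClass a, leftEval f β = 0 := by
  by_contra! hne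
  refine hne a (self_mem_simClass a) (leftEval_eq_zero_of_forall_sharp ha hf fun γ hγ => ?_)
  have hzero := leftEval_eq_zero_of_mem_simClass (sharp_mul_sharp_self f) hγ h
  rw [← sharp_mul_self] at hzero
  refine (leftEval_mul_eq_zero hf.sharp hf (norm_lt_one_of_mem_simClass ha hγ) hzero).resolve_right
    fun ⟨β, hβ, hfβ⟩ => hne β (simClass_eq_of_mem hγ ▸ hβ) hfβ

omit ha in
theorem leftEval_mul_sharp_eq_zero (hf : ConvergesInBall f) (hβ : β ∈ simClass a)
    (h : IsZero f β) : leftEval (f * sharp f) a = 0 := by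
  have hzero {γ : ℍ[ℝ]} (hγ : γ ∈ simClass a) (hN : leftEval (f * sharp f) γ = 0) :
      leftEval (f * sharp f) a = 0 :=
    leftEval_eq_zero_of_mem_simClass (sharp_mul_sharp_self f) (mem_simClass_comm.1 hγ) hN
  rcases h with h | h
  · exact hzero hβ (leftEval_mul_of_eq_zero hf hf.sharp h.1 h.2)
  · rw [isRightZero_iff_isLeftZero_sharp] at h
    refine hzero (star_mem_simClass.2 hβ) ?_
    rw [← sharp_mul_self]
    exact leftEval_mul_of_eq_zero hf.sharp hf h.1 h.2

theorem exists_isLeftZero_of_isZero (hf : ConvergesInBall f) (hβ : β ∈ simClass a)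
    (h : IsZero f β) : ∃ γ ∈ simClass a, IsLeftZero f γ := by
  obtain ⟨γ, hγ, hfγ⟩ :=
    exists_leftEval_eq_zero_of_mul_sharp ha hf (leftEval_mul_sharp_eq_zero hf hβ h)
  exact ⟨γ, hγ, norm_lt_one_of_mem_simClass ha hγ, hfγ⟩

theorem noZerosIn_iff_leftEval_ne_zero (hf : ConvergesInBall f) :
    NoZerosIn f (simClass a) ↔ ∀ β ∈ simClass a, leftEval f β ≠ 0 := by
  refine ⟨fun h β hβ h0 => h β hβ (Or.inl ⟨norm_lt_one_of_mem_simClass ha hβ, h0⟩),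
    fun h β hβ h0 => ?_⟩
  obtain ⟨γ, hγ, hfγ⟩ := exists_isLeftZero_of_isZero ha hf hβ h0
  exact h γ hγ hfγ.2

theorem noZerosIn_iff_leftEval_mul_sharp_ne_zero (hf : ConvergesInBall f) :
    NoZerosIn f (simClass a) ↔ leftEval (f * sharp f) a ≠ 0 := by
  refine ⟨fun h h0 => ?_, fun h β hβ h0 => h (leftEval_mul_sharp_eq_zero hf hβ h0)⟩
  obtain ⟨β, hβ, hfβ⟩ := exists_leftEval_eq_zero_of_mul_sharp ha hf h0
  exact (noZerosIn_iff_leftEval_ne_zero ha hf).1 h β hβ hfβ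

theorem noZerosIn_mul_iff (hf : ConvergesInBall f) (hg : ConvergesInBall g) :
    NoZerosIn (f * g) (simClass a) ↔ NoZerosIn f (simClass a) ∧ NoZerosIn g (simClass a) := by
  rw [noZerosIn_iff_leftEval_mul_sharp_ne_zero ha (hf.mul hg),
    noZerosIn_iff_leftEval_mul_sharp_ne_zero ha hf, noZerosIn_iff_leftEval_mul_sharp_ne_zero ha hg,
    mul_sharp_mul, leftEval_mul_of_sharp_eq (sharp_mul_sharp_self f) (hf.mul hf.sharp)
      (hg.mul hg.sharp) ha, mul_ne_zero_iff]

theorem noZerosIn_C {c : ℍ[ℝ]} (hc : c ≠ 0) : NoZerosIn (C c) (simClass a) := by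
  rw [noZerosIn_iff_leftEval_ne_zero ha (convergesInBall_C c)]
  simp [leftEval_C, hc]

theorem noZerosIn_one : NoZerosIn 1 (simClass a) := by
  simpa using noZerosIn_C ha one_ne_zero

theorem NoZerosIn.pow (h : NoZerosIn f (simClass a)) (hf : ConvergesInBall f) (n : ℕ) :
    NoZerosIn (f ^ n) (simClass a) := by
  induction n with
  | zero => simpa using noZerosIn_one ha
  | succ n ih =>
    rw [pow_succ]
    exact (noZerosIn_mul_iff ha (hf.pow n) hf).2 ⟨ih, h⟩

theorem noZerosIn_kern (hb : ‖b‖ < 1) : NoZerosIn (kern b) (simClass a) := by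
  have hmul : NoZerosIn (kern b * kernInv b) (simClass a) := by
    rw [kern_mul_kernInv]
    exact noZerosIn_one ha
  exact ((noZerosIn_mul_iff ha (convergesInBall_kern hb)
    (convergesInBall_one.sub ((convergesInBall_C _).mul convergesInBall_X))).1 hmul).1

theorem noZerosIn_sphKern (hb : ‖b‖ < 1) : NoZerosIn (sphKern b) (simClass a) :=
  have hb' : ‖star b‖ < 1 := by simpa using hb
  (noZerosIn_mul_iff ha (convergesInBall_kern hb) (convergesInBall_kern hb')).2
    ⟨noZerosIn_kern ha hb, noZerosIn_kern ha hb'⟩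

theorem noZerosIn_rho_iff : NoZerosIn (rho b) (simClass a) ↔ b ∉ simClass a := by
  rw [noZerosIn_iff_leftEval_ne_zero ha (convergesInBall_rho b)]
  simp only [leftEval_rho, sub_ne_zero]
  exact ⟨fun h hb => h b hb rfl, fun h β hβ hβb => h (hβb ▸ hβ)⟩

theorem noZerosIn_blaschke_iff (hb : ‖b‖ < 1) :
    NoZerosIn (blaschke b) (simClass a) ↔ b ∉ simClass a := by
  rw [blaschke, noZerosIn_mul_iff ha (convergesInBall_rho b) (convergesInBall_kern hb),
    noZerosIn_rho_iff ha, and_iff_left (noZerosIn_kern ha hb)]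

theorem leftEval_star_eq_zero_of_blaschke_mul (hβ : β ∈ simClass a) (hγ : γ ∈ simClass a)
    (hne : γ ≠ β) (hg : ConvergesInBall g) (h : leftEval (blaschke β * g) γ = 0) :
    leftEval g (star β) = 0 := by
  have hβ1 := norm_lt_one_of_mem_simClass ha hβ
  have hβ1' := norm_lt_one_of_mem_simClass ha (star_mem_simClass.2 hβ)
  have hcomm : Commute (star β) (leftEval (kern β) (star β)) := commute_leftEval fun k => by
    simp [kern]
  rw [blaschke, mul_assoc, leftEval_rho_mul ha hβ hγ ((convergesInBall_kern hβ1).mul hg),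
    leftEval_mul_of_semiconjBy (convergesInBall_kern hβ1) hg hβ1' hcomm.symm, mul_eq_zero,
    mul_eq_zero, sub_eq_zero] at h
  exact (h.resolve_left hne).resolve_left ((noZerosIn_iff_leftEval_ne_zero ha
    (convergesInBall_kern hβ1)).1 (noZerosIn_kern ha hβ1) _ (star_mem_simClass.2 hβ))

end SimClass

/-! ### Zeros of products of Blaschke factors -/

theorem noZerosIn_blaschkeProd_iff {a : ℍ[ℝ]} (ha : ‖a‖ < 1) {l : List ℍ[ℝ]}
    (hl : ∀ b ∈ l, ‖b‖ < 1) :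
    NoZerosIn (blaschkeProd l) (simClass a) ↔ ∀ b ∈ l, b ∉ simClass a := by
  induction l with
  | nil => simp [noZerosIn_one ha]
  | cons b l ih =>
    rw [List.forall_mem_cons] at hl
    rw [blaschkeProd_cons, noZerosIn_mul_iff ha (convergesInBall_blaschke hl.1)
      (convergesInBall_blaschkeProd hl.2), ih hl.2, noZerosIn_blaschke_iff ha hl.1,
      List.forall_mem_cons]

theorem zerosIn_blaschkeProd_mul_C_iff {a φ : ℍ[ℝ]} {l : List ℍ[ℝ]} (hl : ∀ b ∈ l, ‖b‖ < 1)
    (hφ : φ ≠ 0) : ZerosIn (blaschkeProd l * C φ) (simClass a) ↔ ∀ b ∈ l, b ∈ simClass a := by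
  have hnoZeros {γ : ℍ[ℝ]} (hγ : ‖γ‖ < 1) :
      NoZerosIn (blaschkeProd l * C φ) (simClass γ) ↔ ∀ b ∈ l, b ∉ simClass γ := by
    rw [noZerosIn_mul_iff hγ (convergesInBall_blaschkeProd hl) (convergesInBall_C φ),
      noZerosIn_blaschkeProd_iff hγ hl, and_iff_left (noZerosIn_C hγ hφ)]
  constructor
  · intro h b hb
    by_contra hba
    refine (hnoZeros (hl b hb)).1 (fun γ hγ hzero => hba ?_) b hb (self_mem_simClass b)
    rw [← simClass_eq_of_mem (h γ hzero)]
    exact mem_simClass_comm.1 hγ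
  · intro h γ hzero
    by_contra hγa
    refine (hnoZeros hzero.norm_lt_one).2 (fun b hb hbγ => hγa ?_) γ (self_mem_simClass γ) hzero
    rw [← simClass_eq_of_mem (h b hb)]
    exact mem_simClass_comm.1 hbγ

/-! ### Extracting the zeros in a similarity class -/

theorem constantCoeff_blaschke (a : ℍ[ℝ]) : constantCoeff (blaschke a) = -a := by
  have hkern : constantCoeff (kern a) = 1 := by
    rw [← coeff_zero_eq_constantCoeff_apply, kern, coeff_mk, pow_zero]
  simp [blaschke, rho, hkern]

theorem length_le_order_blaschkeProd {l : List ℍ[ℝ]} (hl : ∀ b ∈ l, b = 0) :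
    (l.length : ℕ∞) ≤ (blaschkeProd l).order := by
  induction l with
  | nil => simp
  | cons b l ih =>
    rw [List.forall_mem_cons] at hl
    have hb : 1 ≤ (blaschke b).order :=
      one_le_order_iff_constCoeff_eq_zero.2 (by rw [constantCoeff_blaschke, hl.1, neg_zero])
    rw [blaschkeProd_cons, order_mul, List.length_cons, Nat.cast_succ, add_comm]
    exact add_le_add hb (ih hl.2)

theorem norm_constantCoeff_divXPowOrder_blaschkeProd {a : ℍ[ℝ]} {l : List ℍ[ℝ]} (ha : a ≠ 0)
    (hl : ∀ b ∈ l, ‖b‖ = ‖a‖) :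
    ‖constantCoeff (divXPowOrder (blaschkeProd l))‖ = ‖a‖ ^ l.length := by
  induction l with
  | nil => simp [divXPowOrder_one]
  | cons b l ih =>
    rw [List.forall_mem_cons] at hl
    have hb : constantCoeff (blaschke b) ≠ 0 := by
      rw [constantCoeff_blaschke, neg_ne_zero, ← norm_ne_zero_iff, hl.1]
      exact norm_ne_zero_iff.2 ha
    have horder : (blaschke b).order = 0 :=
      not_not.1 fun h => hb (order_ne_zero_iff_constCoeff_eq_zero.1 h)
    rw [blaschkeProd_cons, divXPowOrder_mul, map_mul, norm_mul, ih hl.2,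
      constantCoeff_divXPowOrder, horder, ENat.toNat_zero, coeff_zero_eq_constantCoeff_apply,
      constantCoeff_blaschke, norm_neg, hl.1, List.length_cons, pow_succ']

-- If `a ≠ 0`, each factor from `[a]` multiplies the lowest nonzero coefficient by a quaternion of
-- norm `‖a‖`, while the coefficients of `H` are bounded by `1`.
theorem exists_length_le {f : QSeries} (hf0 : f ≠ 0) {a : ℍ[ℝ]} (ha : ‖a‖ < 1) :
    ∃ N : ℕ, ∀ l : List ℍ[ℝ], (∀ b ∈ l, b ∈ simClass a) → ∀ H, IsSchur H →
      f = blaschkeProd l * H → l.length ≤ N := by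
  rcases eq_or_ne a 0 with rfl | ha0
  · refine ⟨f.order.toNat, fun l hl H _ hfl => ?_⟩
    have hl0 : ∀ b ∈ l, b = 0 := fun b hb => by simpa using norm_eq_of_mem_simClass (hl b hb)
    rw [← Nat.cast_le (α := ℕ∞), coe_toNat_order hf0, hfl, order_mul]
    exact le_add_right (length_le_order_blaschkeProd hl0)
  · obtain ⟨N, hN⟩ := exists_pow_lt_of_lt_one (norm_pos_iff.2 (coeff_order hf0)) ha
    refine ⟨N, fun l hl H hH hfl => ?_⟩
    by_contra! hlen
    have hle : ‖coeff f.order.toNat f‖ ≤ ‖a‖ ^ l.length := by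
      rw [← constantCoeff_divXPowOrder, hfl, divXPowOrder_mul, map_mul, norm_mul,
        norm_constantCoeff_divXPowOrder_blaschkeProd ha0 fun b hb =>
          norm_eq_of_mem_simClass (hl b hb), constantCoeff_divXPowOrder]
      exact mul_le_of_le_one_right (by positivity) (hH.norm_coeff_le_one _)
    exact absurd hN (hle.trans (pow_le_pow_of_le_one (norm_nonneg a) ha.le hlen.le)).not_gt

theorem exists_eq_blaschkeProd_mul {f : QSeries} (hf : IsSchur f) (hf0 : f ≠ 0) {a : ℍ[ℝ]}
    (ha : ‖a‖ < 1) :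
    ∃ l : List ℍ[ℝ], (∀ b ∈ l, b ∈ simClass a) ∧ ∃ H, IsSchur H ∧ NoZerosIn H (simClass a) ∧
      f = blaschkeProd l * H := by
  obtain ⟨N, hN⟩ := exists_length_le hf0 ha
  let P (n : ℕ) : Prop := ∃ l : List ℍ[ℝ], (∀ b ∈ l, b ∈ simClass a) ∧
    (∃ H, IsSchur H ∧ f = blaschkeProd l * H) ∧ l.length = n
  have hP0 : P 0 := ⟨[], by simp, ⟨f, hf, by simp⟩, rfl⟩
  classical
  obtain ⟨l, hl, ⟨H, hH, hfl⟩, hlen⟩ : P (Nat.findGreatest P N) :=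
    Nat.findGreatest_spec N.zero_le hP0
  refine ⟨l, hl, H, hH, fun β hβ hzero => ?_, hfl⟩
  obtain ⟨γ, hγ, hzero⟩ := exists_isLeftZero_of_isZero ha hH.convergesInBall hβ hzero
  obtain ⟨G, hG, hHG⟩ := hH.exists_eq_blaschke_mul hzero
  have hlγ : ∀ b ∈ l ++ [γ], b ∈ simClass a := by simpa [or_imp, forall_and] using ⟨hl, hγ⟩
  have hflγ : f = blaschkeProd (l ++ [γ]) * G := by
    rw [blaschkeProd_append, blaschkeProd_cons, blaschkeProd_nil, mul_one, mul_assoc, ← hHG, hfl]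
  have hle : (l ++ [γ]).length ≤ Nat.findGreatest P N :=
    Nat.le_findGreatest (hN _ hlγ G hG hflγ) ⟨_, hlγ, ⟨G, hG, hflγ⟩, rfl⟩
  rw [List.length_append, hlen, List.length_singleton] at hle
  exact absurd hle (Nat.lt_succ_self _).not_ge

/-! ### Spherical chains -/

section Chains

variable {a γ : ℍ[ℝ]} {H H' : QSeries} {l c c' : List ℍ[ℝ]}

theorem IsSphericalChain.map_star (h : IsSphericalChain (simClass a) c) :
    IsSphericalChain (simClass a) (c.map star) := by
  refine ⟨List.forall_mem_map.2 fun b hb => star_mem_simClass.2 (h.1 b hb), ?_⟩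
  rw [List.isChain_map]
  exact h.2.imp fun _ _ hne heq => hne (star_injective heq)

theorem exists_isSphericalChain (hl : ∀ b ∈ l, b ∈ simClass a) :
    ∃ (κ : ℕ) (c : List ℍ[ℝ]), IsSphericalChain (simClass a) c ∧ l.length = 2 * κ + c.length ∧
      blaschkeProd l = sphBlaschke a ^ κ * blaschkeProd c := by
  induction l with
  | nil => exact ⟨0, [], ⟨by simp, by simp⟩, by simp, by simp⟩
  | cons b l ih =>
    rw [List.forall_mem_cons] at hl
    obtain ⟨κ, c, hc, hlen, hprod⟩ := ih hl.2
    have hcons : blaschkeProd (b :: l) = sphBlaschke a ^ κ * (blaschke b * blaschkeProd c) := by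
      rw [blaschkeProd_cons, hprod, ((commute_sphBlaschke a _).pow_left κ).left_comm]
    by_cases hhead : star b ∈ c.head?
    · obtain ⟨c', rfl⟩ := List.head?_eq_some_iff.1 hhead
      refine ⟨κ + 1, c', ⟨(List.forall_mem_cons.1 hc.1).2, hc.2.of_cons⟩, ?_, ?_⟩
      · simp only [List.length_cons] at hlen ⊢
        omega
      · rw [hcons, blaschkeProd_cons, ← mul_assoc (blaschke b), blaschke_mul_blaschke_star hl.1,
          pow_succ, mul_assoc]
    · refine ⟨κ, b :: c, ⟨List.forall_mem_cons.2 ⟨hl.1, hc.1⟩, ?_⟩, ?_, hcons⟩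
      · exact List.isChain_cons.2 ⟨fun d hd hdb => hhead (hdb ▸ hd), hc.2⟩
      · rw [List.length_cons, List.length_cons, hlen, add_assoc]

variable (ha : ‖a‖ < 1)
include ha

theorem convergesInBall_blaschkeProd_of_mem (hl : ∀ b ∈ l, b ∈ simClass a) :
    ConvergesInBall (blaschkeProd l) :=
  convergesInBall_blaschkeProd fun b hb => norm_lt_one_of_mem_simClass ha (hl b hb)

theorem leftEval_blaschkeProd_mul_eq_zero_iff (hc : IsSphericalChain (simClass a) c)
    (hH : ConvergesInBall H) (hz : NoZerosIn H (simClass a)) (hγ : γ ∈ simClass a) :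
    leftEval (blaschkeProd c * H) γ = 0 ↔ c.head? = some γ := by
  induction c generalizing γ with
  | nil => simpa using (noZerosIn_iff_leftEval_ne_zero ha hH).1 hz γ hγ
  | cons b c ih =>
    have hb : b ∈ simClass a := hc.1 b List.mem_cons_self
    have hc' : IsSphericalChain (simClass a) c :=
      ⟨(List.forall_mem_cons.1 hc.1).2, hc.2.of_cons⟩
    have hconv := (convergesInBall_blaschkeProd_of_mem ha hc'.1).mul hH
    rw [blaschkeProd_cons, mul_assoc, List.head?_cons, Option.some_inj]
    constructor
    · intro h
      by_contra! hne
      have hstar := leftEval_star_eq_zero_of_blaschke_mul ha hb hγ hne.symm hconv h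
      exact (List.isChain_cons.1 hc.2).1 _ ((ih hc' (star_mem_simClass.2 hb)).1 hstar) rfl
    · rintro rfl
      have hb1 := norm_lt_one_of_mem_simClass ha hb
      rw [blaschke, mul_assoc]
      exact leftEval_rho_mul_self ((convergesInBall_kern hb1).mul hconv) hb1

theorem IsSphericalChain.eq_of_blaschkeProd_mul_eq (hc : IsSphericalChain (simClass a) c)
    (hc' : IsSphericalChain (simClass a) c') (hH : ConvergesInBall H)
    (hz : NoZerosIn H (simClass a)) (hH' : ConvergesInBall H') (hz' : NoZerosIn H' (simClass a))
    (h : blaschkeProd c * H = blaschkeProd c' * H') : c = c' := by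
  induction c generalizing c' with
  | nil =>
    cases c' with
    | nil => rfl
    | cons d c' =>
      have hd : d ∈ simClass a := hc'.1 d List.mem_cons_self
      have hzero := (leftEval_blaschkeProd_mul_eq_zero_iff ha hc' hH' hz' hd).2 rfl
      rw [← h, leftEval_blaschkeProd_mul_eq_zero_iff ha hc hH hz hd] at hzero
      cases hzero
  | cons b c ih =>
    have hb : b ∈ simClass a := hc.1 b List.mem_cons_self
    have hzero := (leftEval_blaschkeProd_mul_eq_zero_iff ha hc hH hz hb).2 rfl
    rw [h, leftEval_blaschkeProd_mul_eq_zero_iff ha hc' hH' hz' hb] at hzero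
    obtain ⟨c', rfl⟩ := List.head?_eq_some_iff.1 hzero
    rw [blaschkeProd_cons, blaschkeProd_cons, mul_assoc, mul_assoc] at h
    rw [ih ⟨(List.forall_mem_cons.1 hc.1).2, hc.2.of_cons⟩
      ⟨(List.forall_mem_cons.1 hc'.1).2, hc'.2.of_cons⟩ (mul_left_cancel₀ (blaschke_ne_zero b) h)]

theorem IsSphericalChain.not_isSphericalZero (hc : IsSphericalChain (simClass a) c)
    (hre : ∀ x : ℝ, a ≠ x) (hH : ConvergesInBall H) (hz : NoZerosIn H (simClass a)) :
    ¬ IsSphericalZero (blaschkeProd c * H) (simClass a) := by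
  rw [isSphericalZero_iff ha hre ((convergesInBall_blaschkeProd_of_mem ha hc.1).mul hH)]
  rintro ⟨g, hg, heq⟩
  have hhead : ∀ γ ∈ simClass a, c.head? = some γ := fun γ hγ => by
    rw [← leftEval_blaschkeProd_mul_eq_zero_iff ha hc hH hz hγ, heq]
    exact leftEval_sphPoly_mul ha hg hγ
  have hself := self_mem_simClass a
  have hstar : star a = a := Option.some_injective _
    ((hhead _ (star_mem_simClass.2 hself)).symm.trans (hhead a hself))
  exact hre _ (Quaternion.star_eq_self.1 hstar)

end Chains

/-! ### Multiplicities -/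

theorem le_of_pow_mul_eq_pow_mul {M : Type*} [MonoidWithZero M] [IsLeftCancelMulZero M]
    {p g g' : M} (hp : p ≠ 0) {m n : ℕ} (h : p ^ m * g = p ^ n * g')
    (hg : ∀ d, g ≠ p * (p ^ d * g')) : n ≤ m := by
  by_contra! hlt
  obtain ⟨d, rfl⟩ := Nat.exists_eq_add_of_lt hlt
  rw [add_assoc, pow_add, pow_succ', mul_assoc, mul_assoc] at h
  exact hg d (mul_left_cancel₀ (pow_ne_zero m hp) h)

theorem HasRealMult.unique {f : QSeries} {x : ℝ} {m n : ℕ} (hx : ‖(x : ℍ[ℝ])‖ < 1)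
    (hm : HasRealMult f x m) (hn : HasRealMult f x n) : m = n := by
  have hle {m n : ℕ} (hm : HasRealMult f x m) (hn : HasRealMult f x n) : n ≤ m := by
    obtain ⟨g, -, hgz, rfl⟩ := hm
    obtain ⟨g', hg', -, h⟩ := hn
    refine le_of_pow_mul_eq_pow_mul (rho_ne_zero _) h fun d hd => hgz (Or.inl ⟨hx, ?_⟩)
    rw [hd]
    exact leftEval_rho_mul_self
      (((convergesInBall_rho _).pow d).mul (inH1_iff_convergesInBall.1 hg')) hx
  exact le_antisymm (hle hn hm) (hle hm hn)

theorem HasRealMult.sharp {f : QSeries} {x : ℝ} {n : ℕ} (h : HasRealMult f x n) :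
    HasRealMult (sharp f) x n := by
  obtain ⟨g, hg, hgz, rfl⟩ := h
  have hrho : QSchur.sharp (rho (x : ℍ[ℝ])) = rho x := by rw [sharp_rho, Quaternion.star_coe]
  refine ⟨QSchur.sharp g, (inH1_iff_convergesInBall.1 hg).sharp.inH1, fun hz => hgz ?_, ?_⟩
  · simpa using isZero_sharp_iff.1 hz
  · rw [sharp_mul, sharp_pow, hrho, ((commute_of_sharp_eq hrho _).pow_left n).eq]

theorem hasRealMult_blaschke_pow_mul {x : ℝ} (hx : ‖(x : ℍ[ℝ])‖ < 1) {H : QSeries}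
    (hH : ConvergesInBall H) (hz : NoZerosIn H (simClass (x : ℍ[ℝ]))) (n : ℕ) :
    HasRealMult (blaschke (x : ℍ[ℝ]) ^ n * H) x n := by
  have hk := convergesInBall_kern hx
  have hcomm : Commute (rho (x : ℍ[ℝ])) (kern x) := commute_rho_kern (by simp)
  have hzero : NoZerosIn (kern (x : ℍ[ℝ]) ^ n * H) (simClass (x : ℍ[ℝ])) :=
    (noZerosIn_mul_iff hx (hk.pow n) hH).2 ⟨(noZerosIn_kern hx hx).pow hx hk n, hz⟩
  refine ⟨kern x ^ n * H, ((hk.pow n).mul hH).inH1, hzero _ (self_mem_simClass _), ?_⟩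
  rw [blaschke, hcomm.mul_pow, mul_assoc]

theorem HasSphMult.unique {f : QSeries} {a : ℍ[ℝ]} {m n : ℕ} (ha : ‖a‖ < 1)
    (hre : ∀ x : ℝ, a ≠ x) (hm : HasSphMult f a m) (hn : HasSphMult f a n) : m = n := by
  have hle {m n : ℕ} (hm : HasSphMult f a m) (hn : HasSphMult f a n) : n ≤ m := by
    obtain ⟨g, hg, hgs, rfl⟩ := hm
    obtain ⟨g', hg', -, h⟩ := hn
    rw [inH1_iff_convergesInBall] at hg hg'
    rw [isSphericalZero_iff ha hre hg] at hgs
    exact le_of_pow_mul_eq_pow_mul (sphPoly_ne_zero a) h fun d hd =>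
      hgs ⟨_, ((convergesInBall_sphPoly a).pow d).mul hg', hd⟩
  exact le_antisymm (hle hn hm) (hle hm hn)

theorem IsSphericalZero.of_sharp {g : QSeries} {a : ℍ[ℝ]}
    (h : IsSphericalZero (sharp g) (simClass a)) : IsSphericalZero g (simClass a) := by
  rcases h with ⟨β, hβ, γ, hγ, hne, hzβ, hzγ⟩ | ⟨β, hβ, γ, hγ, hne, hzβ, hzγ⟩
  · exact Or.inr ⟨star β, star_mem_simClass.2 hβ, star γ, star_mem_simClass.2 hγ,
      star_injective.ne hne, isLeftZero_sharp_iff.1 hzβ, isLeftZero_sharp_iff.1 hzγ⟩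
  · rw [isRightZero_iff_isLeftZero_sharp, sharp_sharp] at hzβ hzγ
    exact Or.inl ⟨star β, star_mem_simClass.2 hβ, star γ, star_mem_simClass.2 hγ,
      star_injective.ne hne, hzβ, hzγ⟩

theorem HasSphMult.sharp {f : QSeries} {a : ℍ[ℝ]} {n : ℕ} (h : HasSphMult f a n) :
    HasSphMult (sharp f) a n := by
  obtain ⟨g, hg, hgs, rfl⟩ := h
  refine ⟨QSchur.sharp g, (inH1_iff_convergesInBall.1 hg).sharp.inH1,
    fun h => hgs h.of_sharp, ?_⟩
  rw [sharp_mul, sharp_pow, sharp_sphPoly, ((commute_sphPoly a _).pow_left n).eq]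

theorem hasSphMult_sphBlaschke_pow_mul {a : ℍ[ℝ]} (ha : ‖a‖ < 1) (hre : ∀ x : ℝ, a ≠ x)
    {H : QSeries} (hH : ConvergesInBall H) (hz : NoZerosIn H (simClass a)) {c : List ℍ[ℝ]}
    (hc : IsSphericalChain (simClass a) c) (n : ℕ) :
    HasSphMult (sphBlaschke a ^ n * (blaschkeProd c * H)) a n := by
  have hk := (convergesInBall_sphKern ha).pow n
  have hzero : NoZerosIn (sphKern a ^ n * H) (simClass a) :=
    (noZerosIn_mul_iff ha hk hH).2
      ⟨(noZerosIn_sphKern ha ha).pow ha (convergesInBall_sphKern ha) n, hz⟩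
  refine ⟨blaschkeProd c * (sphKern a ^ n * H),
    ((convergesInBall_blaschkeProd_of_mem ha hc.1).mul (hk.mul hH)).inH1,
    hc.not_isSphericalZero ha hre (hk.mul hH) hzero, ?_⟩
  rw [((commute_sphBlaschke a _).pow_left n).left_comm, sphBlaschke_eq_sphPoly_mul_sphKern,
    (commute_sphPoly a _).mul_pow, mul_assoc,
    ((commute_sphPoly a (blaschkeProd c)).pow_left n).left_comm]

/-! ### Left Blaschke divisors -/

/-- The factorization `f = b_{l₁} ⋯ b_{lₙ} H` with all `lⱼ` in `[a]` and `H ∈ ℋ₁` without zeros in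
`[a]`. Since `H` need not be in the Schur class, it can absorb the unimodular constant of a finite
Blaschke product, and the uniqueness assertions can be proved at this level. -/
def IsLeftZeroList (f : QSeries) (a : ℍ[ℝ]) (l : List ℍ[ℝ]) : Prop :=
  (∀ b ∈ l, b ∈ simClass a) ∧
    ∃ H, ConvergesInBall H ∧ NoZerosIn H (simClass a) ∧ f = blaschkeProd l * H

namespace IsLeftZeroList

variable {f : QSeries} {a : ℍ[ℝ]} {l l' : List ℍ[ℝ]}

theorem length_pos (h : IsLeftZeroList f a l) (hV : ∃ γ ∈ simClass a, IsZero f γ) :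
    0 < l.length := by
  obtain ⟨-, H, -, hz, rfl⟩ := h
  obtain ⟨γ, hγ, hzero⟩ := hV
  refine List.length_pos_iff.2 fun hnil => hz γ hγ ?_
  rwa [hnil, blaschkeProd_nil, one_mul] at hzero

theorem blaschkeProd_eq_pow {x : ℝ} (h : IsLeftZeroList f x l) :
    blaschkeProd l = blaschke (x : ℍ[ℝ]) ^ l.length := by
  have hl : l = List.replicate l.length (x : ℍ[ℝ]) :=
    List.eq_replicate_iff.2 ⟨rfl, fun b hb => mem_simClass_coe.1 (h.1 b hb)⟩
  rw [blaschkeProd, hl, List.map_replicate, List.prod_replicate, List.length_replicate]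

theorem hasRealMult {x : ℝ} (h : IsLeftZeroList f x l) (hx : ‖(x : ℍ[ℝ])‖ < 1) :
    HasRealMult f x l.length := by
  have hpow := h.blaschkeProd_eq_pow
  obtain ⟨-, H, hH, hz, rfl⟩ := h
  rw [hpow]
  exact hasRealMult_blaschke_pow_mul hx hH hz _

theorem hasSphMult_mul_sharp (h : IsLeftZeroList f a l) (ha : ‖a‖ < 1) (hre : ∀ x : ℝ, a ≠ x) :
    HasSphMult (f * sharp f) a l.length := by
  obtain ⟨hl, H, hH, hz, rfl⟩ := h
  rw [mul_sharp_mul, blaschkeProd_mul_sharp hl, ← one_mul (H * sharp H)]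
  exact hasSphMult_sphBlaschke_pow_mul ha hre (hH.mul hH.sharp)
    ((noZerosIn_mul_iff ha hH hH.sharp).2 ⟨hz, hz.sharp⟩) (c := []) ⟨by simp, by simp⟩ _

theorem exists_isSphericalChain (h : IsLeftZeroList f a l) (ha : ‖a‖ < 1)
    (hre : ∀ x : ℝ, a ≠ x) :
    ∃ (κ : ℕ) (c : List ℍ[ℝ]), IsSphericalChain (simClass a) c ∧ HasSphMult f a κ ∧
      l.length = 2 * κ + c.length ∧ blaschkeProd l = sphBlaschke a ^ κ * blaschkeProd c := by
  obtain ⟨hl, H, hH, hz, rfl⟩ := h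
  obtain ⟨κ, c, hc, hlen, hprod⟩ := QSchur.exists_isSphericalChain hl
  refine ⟨κ, c, hc, ?_, hlen, hprod⟩
  rw [hprod, mul_assoc]
  exact hasSphMult_sphBlaschke_pow_mul ha hre hH hz hc κ

theorem blaschkeProd_eq (ha : ‖a‖ < 1) (h : IsLeftZeroList f a l) (h' : IsLeftZeroList f a l') :
    blaschkeProd l = blaschkeProd l' := by
  by_cases hre : ∃ x : ℝ, a = x
  · obtain ⟨x, rfl⟩ := hre
    rw [h.blaschkeProd_eq_pow, h'.blaschkeProd_eq_pow,
      (h.hasRealMult ha).unique ha (h'.hasRealMult ha)]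
  · push Not at hre
    obtain ⟨κ, c, hc, hκ, -, hprod⟩ := h.exists_isSphericalChain ha hre
    obtain ⟨κ', c', hc', hκ', -, hprod'⟩ := h'.exists_isSphericalChain ha hre
    obtain rfl := hκ.unique ha hre hκ'
    obtain ⟨-, H, hH, hz, rfl⟩ := h
    obtain ⟨-, H', hH', hz', hHH'⟩ := h'
    rw [hprod, hprod', mul_assoc, mul_assoc] at hHH'
    rw [hprod, hprod', hc.eq_of_blaschkeProd_mul_eq ha hc' hH hz hH' hz'
      (mul_left_cancel₀ (pow_ne_zero κ (sphBlaschke_ne_zero a)) hHH')]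

end IsLeftZeroList

theorem exists_isLeftZeroList {f : QSeries} (hf : IsSchur f) (hf0 : f ≠ 0) {a : ℍ[ℝ]}
    (ha : ‖a‖ < 1) : ∃ l, IsLeftZeroList f a l := by
  obtain ⟨l, hl, H, hH, hz, hfl⟩ := exists_eq_blaschkeProd_mul hf hf0 ha
  exact ⟨l, hl, H, hH.convergesInBall, hz, hfl⟩

theorem exists_hasRealMult {f : QSeries} (hf : IsSchur f) (hf0 : f ≠ 0) {x : ℝ}
    (h : IsZero f x) : ∃ n, 0 < n ∧ HasRealMult f x n := by
  obtain ⟨l, hl⟩ := exists_isLeftZeroList hf hf0 h.norm_lt_one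
  exact ⟨l.length, hl.length_pos ⟨x, self_mem_simClass _, h⟩, hl.hasRealMult h.norm_lt_one⟩

theorem exists_hasSphMult {f : QSeries} (hf : IsSchur f) (hf0 : f ≠ 0) {a : ℍ[ℝ]} (ha : ‖a‖ < 1)
    (hre : ∀ x : ℝ, a ≠ x) (hV : ∃ γ ∈ simClass a, IsZero f γ) :
    ∃ κ m, HasSphMult f a κ ∧ HasSphMult (f * sharp f) a m ∧ 2 * κ ≤ m ∧ 0 < m := by
  obtain ⟨l, hl⟩ := exists_isLeftZeroList hf hf0 ha
  obtain ⟨κ, c, -, hκ, hlen, -⟩ := hl.exists_isSphericalChain ha hre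
  exact ⟨κ, l.length, hκ, hl.hasSphMult_mul_sharp ha hre, by omega, hl.length_pos hV⟩

theorem exists_isLeftBlaschkeDivisor {f : QSeries} (hf : IsSchur f) (hf0 : f ≠ 0) {a : ℍ[ℝ]}
    (ha : ‖a‖ < 1) : ∃ B, IsBlaschkeProd B ∧ IsLeftBlaschkeDivisor f (simClass a) B := by
  obtain ⟨l, hl, H, hH, hz, hfl⟩ := exists_eq_blaschkeProd_mul hf hf0 ha
  have hl1 : ∀ b ∈ l, ‖b‖ < 1 := fun b hb => norm_lt_one_of_mem_simClass ha (hl b hb)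
  have hB : IsBlaschkeProd (blaschkeProd l) := ⟨l, hl1, rfl⟩
  have hzeros := (zerosIn_blaschkeProd_mul_C_iff hl1 one_ne_zero).2 hl
  rw [map_one, mul_one] at hzeros
  exact ⟨blaschkeProd l, hB, ⟨_, hB, 1, norm_one, by simp⟩, hzeros, H, hH, hz, hfl⟩

namespace IsLeftBlaschkeDivisor

variable {f B B' : QSeries} {a φ : ℍ[ℝ]} {l : List ℍ[ℝ]} (ha : ‖a‖ < 1)
include ha

theorem isLeftZeroList (hl : ∀ b ∈ l, ‖b‖ < 1) (hφ : φ ≠ 0)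
    (h : IsLeftBlaschkeDivisor f (simClass a) (blaschkeProd l * C φ)) : IsLeftZeroList f a l := by
  obtain ⟨-, hzeros, H, hH, hz, hfH⟩ := h
  have hHc := hH.convergesInBall
  exact ⟨(zerosIn_blaschkeProd_mul_C_iff hl hφ).1 hzeros, C φ * H, (convergesInBall_C φ).mul hHc,
    (noZerosIn_mul_iff ha (convergesInBall_C φ) hHc).2 ⟨noZerosIn_C ha hφ, hz⟩,
    by rw [hfH, mul_assoc]⟩

theorem exists_isLeftZeroList (h : IsLeftBlaschkeDivisor f (simClass a) B)
    (hB : IsBlaschkeProd B) : ∃ l, IsLeftZeroList f a l ∧ B = blaschkeProd l := by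
  obtain ⟨l, hl, rfl⟩ := hB
  exact ⟨l, isLeftZeroList ha hl one_ne_zero (by rwa [map_one, mul_one]), rfl⟩

theorem exists_eq_mul_C (h : IsLeftBlaschkeDivisor f (simClass a) B) (hB : IsBlaschkeProd B)
    (h' : IsLeftBlaschkeDivisor f (simClass a) B') : ∃ φ : ℍ[ℝ], ‖φ‖ = 1 ∧ B' = B * C φ := by
  obtain ⟨l, hl, rfl⟩ := h.exists_isLeftZeroList ha hB
  obtain ⟨_, ⟨l', hl', rfl⟩, φ, hφ, rfl⟩ := h'.1
  refine ⟨φ, hφ, congrArg (· * C φ) ?_⟩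
  exact (isLeftZeroList ha hl' (norm_ne_zero_iff.1 (by simp [hφ])) h').blaschkeProd_eq ha hl

protected theorem eq (h : IsLeftBlaschkeDivisor f (simClass a) B) (hB : IsBlaschkeProd B)
    (h' : IsLeftBlaschkeDivisor f (simClass a) B') (hB' : IsBlaschkeProd B') : B = B' := by
  obtain ⟨l, hl, rfl⟩ := h.exists_isLeftZeroList ha hB
  obtain ⟨l', hl', rfl⟩ := h'.exists_isLeftZeroList ha hB'
  exact hl.blaschkeProd_eq ha hl'

omit ha in
theorem eq_blaschke_pow {x : ℝ} (hx : ‖(x : ℍ[ℝ])‖ < 1)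
    (h : IsLeftBlaschkeDivisor f (simClass (x : ℍ[ℝ])) B) (hB : IsBlaschkeProd B) {n : ℕ}
    (hn : HasRealMult f x n) : B = blaschke (x : ℍ[ℝ]) ^ n := by
  obtain ⟨l, hl, rfl⟩ := h.exists_isLeftZeroList hx hB
  rw [hl.blaschkeProd_eq_pow, (hl.hasRealMult hx).unique hx hn]

theorem existsUnique_isSphericalChain (hre : ∀ x : ℝ, a ≠ x)
    (h : IsLeftBlaschkeDivisor f (simClass a) B) (hB : IsBlaschkeProd B) {κ k : ℕ}
    (hκ : HasSphMult f a κ) (hk : HasSphMult (f * QSchur.sharp f) a (2 * κ + k)) :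
    ∃! c : List ℍ[ℝ], c.length = k ∧ IsSphericalChain (simClass a) c ∧
      B = sphBlaschke a ^ κ * blaschkeProd c := by
  obtain ⟨l, hl, rfl⟩ := h.exists_isLeftZeroList ha hB
  obtain ⟨κ', c, hc, hκ', hlen, hprod⟩ := hl.exists_isSphericalChain ha hre
  obtain rfl := hκ.unique ha hre hκ'
  have hlen' := hk.unique ha hre (hl.hasSphMult_mul_sharp ha hre)
  refine ⟨c, ⟨by omega, hc, hprod⟩, fun c' ⟨_, hc', hprod'⟩ => ?_⟩
  have hcc' : blaschkeProd c' = blaschkeProd c :=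
    mul_left_cancel₀ (pow_ne_zero κ (sphBlaschke_ne_zero a)) (hprod'.symm.trans hprod)
  exact hc'.eq_of_blaschkeProd_mul_eq ha hc convergesInBall_one (noZerosIn_one ha)
    convergesInBall_one (noZerosIn_one ha) (by rw [hcc'])

theorem eq_sphBlaschke_pow (hre : ∀ x : ℝ, a ≠ x) (h : IsLeftBlaschkeDivisor f (simClass a) B)
    (hB : IsBlaschkeProd B) {κ : ℕ} (hκ : HasSphMult f a κ)
    (hk : HasSphMult (f * QSchur.sharp f) a (2 * κ)) : B = sphBlaschke a ^ κ := by
  obtain ⟨c, hlen, -, hprod⟩ := (h.existsUnique_isSphericalChain ha hre hB hκ (k := 0) hk).exists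
  rwa [List.length_eq_zero_iff.1 hlen, blaschkeProd_nil, mul_one] at hprod

end IsLeftBlaschkeDivisor

/-! ### Right Blaschke divisors -/

theorem IsBlaschkeProd.sharp {B : QSeries} (h : IsBlaschkeProd B) : IsBlaschkeProd (sharp B) := by
  obtain ⟨l, hl, rfl⟩ := h
  refine ⟨(l.map star).reverse, ?_, sharp_blaschkeProd l⟩
  simpa using hl

theorem exists_semiconjBy_C_blaschkeProd {φ : ℍ[ℝ]} (hφ : ‖φ‖ = 1) {l : List ℍ[ℝ]}
    (hl : ∀ b ∈ l, ‖b‖ < 1) :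
    ∃ l' : List ℍ[ℝ], (∀ b ∈ l', ‖b‖ < 1) ∧
      SemiconjBy (C φ) (blaschkeProd l) (blaschkeProd l') := by
  have hsemi (b : ℍ[ℝ]) : SemiconjBy φ b (φ * b * star φ) := by
    have hstar : star φ * φ = 1 := by
      rw [Quaternion.star_mul_self, Quaternion.normSq_eq_norm_mul_self, hφ]
      simp
    rw [SemiconjBy, mul_assoc _ (star φ), hstar, mul_one]
  refine ⟨l.map fun b => φ * b * star φ, by simpa [hφ] using hl, ?_⟩
  induction l with
  | nil => exact .one_right _
  | cons b l ih =>
    have hb : SemiconjBy (C φ) (blaschke b) (blaschke (φ * b * star φ)) :=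
      semiconjBy_C_blaschke (hsemi b) (by simpa [mul_assoc] using hsemi (star b))
    exact hb.mul_right (ih (List.forall_mem_cons.1 hl).2)

theorem IsFiniteBlaschke.sharp {B : QSeries} (h : IsFiniteBlaschke B) :
    IsFiniteBlaschke (sharp B) := by
  obtain ⟨P, hP, φ, hφ, rfl⟩ := h
  obtain ⟨l, hl, hPl⟩ := hP.sharp
  have hφ' : ‖star φ‖ = 1 := by rwa [norm_star]
  obtain ⟨l', hl', hsemi⟩ := exists_semiconjBy_C_blaschkeProd hφ' hl
  exact ⟨blaschkeProd l', ⟨l', hl', rfl⟩, star φ, hφ',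
    by rw [sharp_mul, sharp_C, hPl]; exact hsemi.eq⟩

theorem ZerosIn.sharp {B : QSeries} {a : ℍ[ℝ]} (h : ZerosIn B (simClass a)) :
    ZerosIn (sharp B) (simClass a) := fun _ hγ =>
  star_mem_simClass.1 (h _ (isZero_sharp_iff.1 hγ))

theorem IsLeftBlaschkeDivisor.sharp {f B : QSeries} {a : ℍ[ℝ]}
    (h : IsLeftBlaschkeDivisor f (simClass a) B) :
    IsRightBlaschkeDivisor (sharp f) (simClass a) (sharp B) := by
  obtain ⟨hB, hzeros, H, hH, hz, rfl⟩ := h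
  exact ⟨hB.sharp, hzeros.sharp, _, hH.sharp, hz.sharp, sharp_mul _ _⟩

theorem exists_isRightBlaschkeDivisor {f : QSeries} (hf : IsSchur f) (hf0 : f ≠ 0) {a : ℍ[ℝ]}
    (ha : ‖a‖ < 1) : ∃ B, IsBlaschkeProd B ∧ IsRightBlaschkeDivisor f (simClass a) B := by
  have hf0' : QSchur.sharp f ≠ 0 := fun h => hf0 (sharp_injective (h.trans sharp_zero.symm))
  obtain ⟨B, hB, h⟩ := exists_isLeftBlaschkeDivisor hf.sharp hf0' ha
  exact ⟨sharp B, hB.sharp, sharp_sharp f ▸ h.sharp⟩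

namespace IsRightBlaschkeDivisor

variable {f B B' : QSeries} {a : ℍ[ℝ]}

protected theorem sharp (h : IsRightBlaschkeDivisor f (simClass a) B) :
    IsLeftBlaschkeDivisor (sharp f) (simClass a) (sharp B) := by
  obtain ⟨hB, hzeros, H, hH, hz, rfl⟩ := h
  exact ⟨hB.sharp, hzeros.sharp, _, hH.sharp, hz.sharp, sharp_mul _ _⟩

theorem exists_eq_C_mul (ha : ‖a‖ < 1) (h : IsRightBlaschkeDivisor f (simClass a) B)
    (hB : IsBlaschkeProd B) (h' : IsRightBlaschkeDivisor f (simClass a) B') :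
    ∃ φ : ℍ[ℝ], ‖φ‖ = 1 ∧ B' = C φ * B := by
  obtain ⟨φ, hφ, heq⟩ := h.sharp.exists_eq_mul_C ha hB.sharp h'.sharp
  refine ⟨star φ, by rwa [norm_star], sharp_injective ?_⟩
  rw [heq, sharp_mul, sharp_C, star_star]

protected theorem eq (ha : ‖a‖ < 1) (h : IsRightBlaschkeDivisor f (simClass a) B)
    (hB : IsBlaschkeProd B) (h' : IsRightBlaschkeDivisor f (simClass a) B')
    (hB' : IsBlaschkeProd B') : B = B' :=
  sharp_injective (h.sharp.eq ha hB.sharp h'.sharp hB'.sharp)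

theorem eq_blaschke_pow {x : ℝ} (hx : ‖(x : ℍ[ℝ])‖ < 1)
    (h : IsRightBlaschkeDivisor f (simClass (x : ℍ[ℝ])) B) (hB : IsBlaschkeProd B) {n : ℕ}
    (hn : HasRealMult f x n) : B = blaschke (x : ℍ[ℝ]) ^ n := by
  apply sharp_injective
  rw [h.sharp.eq_blaschke_pow hx hB.sharp hn.sharp, sharp_pow, sharp_blaschke, Quaternion.star_coe]

theorem existsUnique_isSphericalChain (ha : ‖a‖ < 1) (hre : ∀ x : ℝ, a ≠ x)
    (h : IsRightBlaschkeDivisor f (simClass a) B) (hB : IsBlaschkeProd B) {κ k : ℕ}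
    (hκ : HasSphMult f a κ) (hk : HasSphMult (f * QSchur.sharp f) a (2 * κ + k)) :
    ∃! c : List ℍ[ℝ], c.length = k ∧ IsSphericalChain (simClass a) c ∧
      B = blaschkeProd c.reverse * sphBlaschke a ^ κ := by
  have hk' : HasSphMult (QSchur.sharp f * QSchur.sharp (QSchur.sharp f)) a (2 * κ + k) := by
    rwa [sharp_sharp, sharp_mul_self]
  have hstar : Function.Involutive (List.map star : List ℍ[ℝ] → List ℍ[ℝ]) :=
    fun c => by simp [Function.comp_def]
  have hsharp (c : List ℍ[ℝ]) : QSchur.sharp (blaschkeProd c.reverse * sphBlaschke a ^ κ) =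
      sphBlaschke a ^ κ * blaschkeProd (c.map star) := by
    rw [sharp_mul, sharp_pow, sharp_sphBlaschke, sharp_blaschkeProd, List.map_reverse,
      List.reverse_reverse]
  refine (Equiv.existsUnique_congr (hstar.toPerm _) fun c => ?_).2
    (h.sharp.existsUnique_isSphericalChain ha hre hB.sharp hκ.sharp hk')
  have hchain : IsSphericalChain (simClass a) (c.map star) ↔ IsSphericalChain (simClass a) c :=
    ⟨fun hc => hstar c ▸ hc.map_star, fun hc => hc.map_star⟩
  rw [Function.Involutive.coe_toPerm, List.length_map, hchain, ← hsharp,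
    sharp_injective.eq_iff]

theorem eq_sphBlaschke_pow (ha : ‖a‖ < 1) (hre : ∀ x : ℝ, a ≠ x)
    (h : IsRightBlaschkeDivisor f (simClass a) B) (hB : IsBlaschkeProd B) {κ : ℕ}
    (hκ : HasSphMult f a κ) (hk : HasSphMult (f * QSchur.sharp f) a (2 * κ)) :
    B = sphBlaschke a ^ κ := by
  obtain ⟨c, hlen, -, hprod⟩ := (h.existsUnique_isSphericalChain ha hre hB hκ (k := 0) hk).exists
  rwa [List.length_eq_zero_iff.1 hlen, List.reverse_nil, blaschkeProd_nil, one_mul] at hprod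

end IsRightBlaschkeDivisor

end QSchur

theorem theorem3 (f : QSeries) (hf : IsSchur f) (hf0 : f ≠ 0) (α : ℍ[ℝ])
    (hV : ∃ γ ∈ simClass α, IsZero f γ) :
    ∃ Bl Br : QSeries,
      -- existence
      (IsBlaschkeProd Bl ∧ IsLeftBlaschkeDivisor f (simClass α) Bl) ∧
      (IsBlaschkeProd Br ∧ IsRightBlaschkeDivisor f (simClass α) Br) ∧
      -- uniqueness
      (∀ B : QSeries, IsBlaschkeProd B → IsLeftBlaschkeDivisor f (simClass α) B → B = Bl) ∧
      (∀ B : QSeries, IsBlaschkeProd B → IsRightBlaschkeDivisor f (simClass α) B → B = Br) ∧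
      -- uniqueness up to a unimodular constant without the normalization
      (∀ B : QSeries, IsLeftBlaschkeDivisor f (simClass α) B →
        ∃ φ : ℍ[ℝ], ‖φ‖ = 1 ∧ B = Bl * PowerSeries.C φ) ∧
      (∀ B : QSeries, IsRightBlaschkeDivisor f (simClass α) B →
        ∃ φ : ℍ[ℝ], ‖φ‖ = 1 ∧ B = PowerSeries.C φ * Br) ∧
      -- the class of a real point
      (∀ x : ℝ, α = (x : ℍ[ℝ]) →
        (∃ n : ℕ, 0 < n ∧ HasRealMult f x n) ∧
        ∀ n : ℕ, HasRealMult f x n →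
          Bl = blaschke (x : ℍ[ℝ]) ^ n ∧ Br = blaschke (x : ℍ[ℝ]) ^ n) ∧
      -- the class of a non-real point
      ((∀ x : ℝ, α ≠ (x : ℍ[ℝ])) →
        (∃ κ m : ℕ, HasSphMult f α κ ∧ HasSphMult (f * sharp f) α m ∧ 2 * κ ≤ m ∧ 0 < m) ∧
        (∀ κ : ℕ, 0 < κ → HasSphMult f α κ → HasSphMult (f * sharp f) α (2 * κ) →
          Bl = sphBlaschke α ^ κ ∧ Br = sphBlaschke α ^ κ) ∧
        (∀ κ k : ℕ, 0 < k → HasSphMult f α κ → HasSphMult (f * sharp f) α (2 * κ + k) →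
          (∃! l : List ℍ[ℝ], l.length = k ∧ IsSphericalChain (simClass α) l ∧
            Bl = sphBlaschke α ^ κ * (l.map blaschke).prod) ∧
          (∃! l : List ℍ[ℝ], l.length = k ∧ IsSphericalChain (simClass α) l ∧
            Br = (l.reverse.map blaschke).prod * sphBlaschke α ^ κ))) := by
  obtain ⟨γ, hγ, hzero⟩ := hV
  have hα : ‖α‖ < 1 := norm_eq_of_mem_simClass hγ ▸ hzero.norm_lt_one
  obtain ⟨Bl, hBl, hl⟩ := exists_isLeftBlaschkeDivisor hf hf0 hα
  obtain ⟨Br, hBr, hr⟩ := exists_isRightBlaschkeDivisor hf hf0 hα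
  refine ⟨Bl, Br, ⟨hBl, hl⟩, ⟨hBr, hr⟩, fun B hB h => h.eq hα hB hl hBl,
    fun B hB h => h.eq hα hB hr hBr, fun B h => hl.exists_eq_mul_C hα hBl h,
    fun B h => hr.exists_eq_C_mul hα hBr h, ?_, fun hre => ⟨?_, ?_, ?_⟩⟩
  · rintro x rfl
    obtain rfl := mem_simClass_coe.1 hγ
    exact ⟨exists_hasRealMult hf hf0 hzero, fun n hn =>
      ⟨hl.eq_blaschke_pow hα hBl hn, hr.eq_blaschke_pow hα hBr hn⟩⟩
  · exact exists_hasSphMult hf hf0 hα hre ⟨γ, hγ, hzero⟩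
  · exact fun κ _ hκ hk =>
      ⟨hl.eq_sphBlaschke_pow hα hre hBl hκ hk, hr.eq_sphBlaschke_pow hα hre hBr hκ hk⟩
  · exact fun κ k _ hκ hk => ⟨hl.existsUnique_isSphericalChain hα hre hBl hκ hk,
      hr.existsUnique_isSphericalChain hα hre hBr hκ hk⟩
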